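/- Consider a route with $N\ge 1$ stages. New sessions arrive as a Poisson process of rate $\lambda>0$. A session has a duration $T\ge 0$ and (residual) cell dwell times $\tau_1,\dots,\tau_N\ge 0$; the vectors $(T,\tau_1,\dots,\tau_N)$ of different sessions are i.i.d. and independent of the arrivals, with an arbitrary joint law (no independence between $T,\tau_1,\dots,\tau_N$ is assumed). A session always has a first stage, and it has a $j$th stage, $j\ge 2$, if $T>\sum_{i<j}\tau_i$. If it has a $j$th stage, this stage begins $\sum_{i<j}\tau_i$ after the arrival of the session and lasts for the channel holding time $t_j=\min\{T-\sum_{i<j}\tau_i,\ \tau_j\}$, after which the session enters stage $j+1$ or, if it has no such stage, leaves the network. Let $p_k$ be the probability that a session has exactly $k$ stages, and $\bar t_j$ the conditional mean of $t_j$ given that the session has a $j$th stage. Assume that every stage is reached with positive probability and that $0<\bar t_j<\infty$ for all $j$. (Finiteness of $\bar t_j$ is automatic if the channel holding times are discrete with finitely many values.) Let $x_j(t)$ be the number of sessions that are in stage $j$ at time $t$, $\mathbf x(t)=(x_1(t),\dots,x_N(t))$, and $$w_j=\lambda\Bigl(1-\sum_{n<j}p_n\Bigr)\bar t_j ,\qquad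 \pi(\mathbf x)=\prod_{j=1}^N e^{-w_j}\frac{w_j^{x_j}}{x_j!}\qquad(\mathbf x\in\mathbb Z_{\ge 0}^N).$$ The corresponding memoryless network is the open Jackson network with $N$ queues, each with infinitely many exponential servers of rate $1/\bar t_j$, with Poisson exogenous arrivals of rate $\lambda$ to queue $1$, in which a unit served at queue $k$ moves to queue $k+1$ with probability $\sum_{n>k}p_n/\sum_{n\ge k}p_n$ and leaves the network with probability $p_k/\sum_{n\ge k}p_n$. Theorem. The single-route network has the same stationary user distribution as the corresponding memoryless network, namely $\pi$, the product of the Poisson laws with means $w_j$. That is: (i) $\pi$ is the unique stationary distribution of the memoryless network, i.e. the unique probability distribution on $\mathbb Z_{\ge 0}^N$ that satisfies its global balance equations; (ii) if sessions arrive as a Poisson process on the whole time axis $\mathbb R$ (stationary regime), then $\mathbf x(t)$ has law $\pi$ for every $t\in\mathbb R$; (iii) if the single-route network is empty at time $0$ and sessions arrive after time $0$, then the law of $\mathbf x(t)$ converges to $\pi$ pointwise as $t\to\infty$. -/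

import Mathlib

open MeasureTheory ProbabilityTheory Filter Topology
open scoped Nat

namespace SingleRoute

/-- A session on a route with `N` stages: the pair `(T, τ)` of the session duration `T` and
the (residual) cell dwell times `τ j` of its user. Stages are numbered from `0`, so that the
index `j : Fin N` is the `(j + 1)`-st stage of the route. -/
abbrev Session (N : ℕ) : Type := ℝ × (Fin N → ℝ)

/-- Time from the start of a session until its user would enter stage `j`. -/
noncomputable def entryAge {N : ℕ} (s : Session N) (j : Fin N) : ℝ :=
  ∑ i ∈ Finset.Iio j, s.2 i

/-- The session has a `j`-th stage: always for the first stage, and otherwise if the session is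
still active when its user enters stage `j`. -/
def Reaches {N : ℕ} (s : Session N) (j : Fin N) : Prop :=
  (j : ℕ) = 0 ∨ entryAge s j < s.1

/-- Channel holding time of stage `j` (meaningful if the session has a `j`-th stage). -/
noncomputable def holdingTime {N : ℕ} (s : Session N) (j : Fin N) : ℝ :=
  min (s.1 - entryAge s j) (s.2 j)

/-- Stage `k` is the last one of the session: the session outlives the dwell times of the stages
before `k`, but, unless `k` is the last stage of the route, not the dwell time of stage `k`. -/
def IsLastStage {N : ℕ} (s : Session N) (k : Fin N) : Prop :=
  ((k : ℕ) ≠ 0 → ∑ i ∈ Finset.Iio k, s.2 i < s.1) ∧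
    ((k : ℕ) + 1 ≠ N → s.1 ≤ ∑ i ∈ Finset.Iic k, s.2 i)

/-- Probability that stage `k` is the last one of a session with law `μ`. -/
noncomputable def lastProb {N : ℕ} (μ : Measure (Session N)) (k : Fin N) : ℝ :=
  μ.real {s | IsLastStage s k}

/-- Mean channel holding time of stage `j`, given that the session has a `j`-th stage. -/
noncomputable def meanHolding {N : ℕ} (μ : Measure (Session N)) (j : Fin N) : ℝ :=
  ∫ s, holdingTime s j ∂(μ[|{s | Reaches s j}])

/-- The numbers `w j = λ (1 - ∑ n < j, p n) t̄ j`. -/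
noncomputable def load {N : ℕ} (lam : ℝ) (μ : Measure (Session N)) (j : Fin N) : ℝ :=
  lam * (1 - ∑ n ∈ Finset.Iio j, lastProb μ n) * meanHolding μ j

/-! ### The single-route network -/

/-- New sessions arrive as a Poisson process of rate `lam` on the whole time axis, given by
independent exponential variables `E n`, `n : ℤ` (see `arrivalTime`). The sessions `S n` are
independent with common law `μ`, and independent of the arrivals. Nothing is assumed on the
dependence between the components of one session. -/
structure IsSessionStream {Ω : Type*} [MeasurableSpace Ω] (P : Measure Ω) {N : ℕ} (lam : ℝ)
    (μ : Measure (Session N)) (E : ℤ → Ω → ℝ) (S : ℤ → Ω → Session N) : Prop where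
  hasLaw_gap : ∀ n, HasLaw (E n) (expMeasure lam) P
  hasLaw_session : ∀ n, HasLaw (S n) μ P
  indep_gap : iIndepFun E P
  indep_session : iIndepFun S P
  indep : IndepFun (fun ω n => E n ω) (fun ω n => S n ω) P

/-- The arrival time of session `n`. The arrivals after time `0` are `E 1`, `E 1 + E 2`, …, and
those before time `0` are `-E 0`, `-(E 0 + E (-1))`, …: two independent Poisson processes on the
two half-lines, that is, a Poisson process on the real line. -/
noncomputable def arrivalTime {Ω : Type*} (E : ℤ → Ω → ℝ) (n : ℤ) (ω : Ω) : ℝ :=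
  if 0 < n then ∑ i ∈ Finset.Icc 1 n, E i ω else -∑ i ∈ Finset.Icc n 0, E i ω

/-- At time `t`, a session `s` that arrived at time `a` is in stage `j`. -/
def InStage {N : ℕ} (a : ℝ) (s : Session N) (j : Fin N) (t : ℝ) : Prop :=
  Reaches s j ∧ a + entryAge s j ≤ t ∧ t < a + entryAge s j + holdingTime s j

/-- The number of sessions, among those with index in `I`, that are in stage `j` at time `t`. -/
noncomputable def occupancy {Ω : Type*} {N : ℕ} (E : ℤ → Ω → ℝ) (S : ℤ → Ω → Session N)
    (I : Set ℤ) (t : ℝ) (ω : Ω) (j : Fin N) : ℕ∞ :=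
  {n ∈ I | InStage (arrivalTime E n ω) (S n ω) j t}.encard

/-! ### The memoryless network -/

/-- Transition rates of an open Jackson network with infinitely many exponential servers at
every queue: external arrivals come to queue `j` at rate `a j`, every unit in queue `j` is served
at rate `m j`, and on leaving queue `j` it moves to queue `k` with probability `r j k` and leaves
the network with probability `d j`. -/
noncomputable def jacksonRate {N : ℕ} (a m : Fin N → ℝ) (r : Fin N → Fin N → ℝ) (d : Fin N → ℝ)
    (x y : Fin N → ℕ) : ℝ :=
  (∑ j, if y = x + Pi.single j 1 then a j else 0) +
  (∑ j, ∑ k, if y + Pi.single j 1 = x + Pi.single k 1 then x j * m j * r j k else 0) +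
  ∑ j, if y + Pi.single j 1 = x then x j * m j * d j else 0

/-- Transition rates of the memoryless network that corresponds to the single-route network:
the exogenous arrivals enter the first queue, the service rate is the inverse of the mean channel
holding time, and after stage `j` a unit enters stage `j + 1` or leaves with the conditional
probabilities that a session of the original network does so. -/
noncomputable def memorylessRate {N : ℕ} (lam : ℝ) (μ : Measure (Session N)) :
    (Fin N → ℕ) → (Fin N → ℕ) → ℝ :=
  jacksonRate
    (fun j => if (j : ℕ) = 0 then lam else 0)
    (fun j => 1 / meanHolding μ j)
    (fun j k => if (k : ℕ) = j + 1 then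
      (∑ n ∈ Finset.Ici k, lastProb μ n) / ∑ n ∈ Finset.Ici j, lastProb μ n else 0)
    (fun j => lastProb μ j / ∑ n ∈ Finset.Ici j, lastProb μ n)

/-- `π` is a stationary distribution of the Markov jump process with transition rates `q`:
a probability distribution that satisfies the global balance equations (flow into `y` equals
flow out of `y`). -/
structure IsStationaryDistribution {X : Type*} (q : X → X → ℝ) (π : X → ℝ) : Prop where
  nonneg : ∀ x, 0 ≤ π x
  hasSum_one : HasSum π 1
  balance : ∀ y, HasSum (fun x => π x * q x y) (π y * ∑' z, q y z)

end SingleRoute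

/-! Stationary regime. A session arriving at time `a` is in stage `j` at time `t` with probability
`stageProb μ j (t - a)`, and it is in at most one stage at a time. Sorting the arrivals of a Poisson
process by the stage they occupy at time `t` is therefore a position-dependent thinning, which gives
independent Poisson counts with means `lam * ∫ stageProb μ j`. By Tonelli this integral is the
expectation of the holding time on the event that stage `j` is reached, so the mean is `load lam μ
j`. Only this expectation enters, hence the insensitivity to the joint law of a session. If arrivals
start at time `0`, the integral stops at age `t`, and the missing tail vanishes as `t → ∞`.

The thinning statement is derived from the exponential gaps by a martingale. After `n` points, with
the last one at time `a`, the conditional probability that the final counts equal `x` should be the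
Poisson weight, with means the loads left after `a`, of `x` minus the counts so far. That its
expectation does not depend on `n` is a one-step identity,
`integral_exp_mul_poissonWeights_tailLoad`, which rests on the derivative of the Poisson weight in
its mean. As `n → ∞` the arrival times tend to infinity and the remaining loads to zero, so the
weights converge to the indicator of the event (`measure_encard_hitIndices_add_eq`).

Memoryless network. The product of Poisson laws satisfies global balance because of the traffic
equations. For uniqueness, let `ν` be another stationary distribution. The ratio `ν / π` cannot
increase along a transition (`IsStationaryDistribution.div_le_div`). From any state a unit can
arrive, pass through all queues and leave; around this cycle the ratio is constant, so adding a unit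
to any queue does not change it. Hence `ν` is a multiple of `π`, and normalization makes them equal.
-/

namespace SingleRoute

/-! ### Stationary distributions of jump processes -/

/-- The ratio of a stationary distribution to a positive stationary distribution with finite mean
exit rate does not decrease when a transition is followed backwards. -/
theorem IsStationaryDistribution.div_le_div {X : Type*} {q : X → X → ℝ} {π ν : X → ℝ}
    (hq : ∀ x y, 0 ≤ q x y) (hout : ∀ x, Summable (q x))
    (hπ : IsStationaryDistribution q π) (hpos : ∀ x, 0 < π x)
    (hsum : Summable fun x => π x * ∑' z, q x z)
    (hν : IsStationaryDistribution q ν) {x y : X} (hyx : 0 < q y x) :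
    ν x / π x ≤ ν y / π y := by
  set c := ν x / π x with hc
  have hc0 : 0 ≤ c := div_nonneg (hν.nonneg x) (hpos x).le
  -- The minimum of two invariant measures has inflow at most its outflow at every state. Its total
  -- flow is finite because `h ≤ c * π`, so total inflow equals total outflow and equality must hold
  -- at every state.
  set h : X → ℝ := fun z => min (ν z) (c * π z) with hh
  have h0 : ∀ z, 0 ≤ h z := fun z => le_min (hν.nonneg z) (mul_nonneg hc0 (hpos z).le)
  have hle : ∀ z, h z ≤ c * π z := fun z => min_le_right _ _
  have hleν : ∀ z, h z ≤ ν z := fun z => min_le_left _ _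
  have hcol : ∀ z, Summable fun u => h u * q u z := fun z =>
    Summable.of_nonneg_of_le (fun u => mul_nonneg (h0 u) (hq u z))
      (fun u => mul_le_mul_of_nonneg_right (hleν u) (hq u z)) (hν.balance z).summable
  have hout0 : ∀ z, 0 ≤ ∑' u, q z u := fun z => tsum_nonneg (hq z)
  have hcπ : ∀ z, HasSum (fun u => c * π u * q u z) (c * π z * ∑' u, q z u) := fun z => by
    simpa only [mul_assoc] using (hπ.balance z).mul_left c
  have hin : ∀ z, ∑' u, h u * q u z ≤ h z * ∑' u, q z u := fun z => by
    rw [hh]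
    simp only
    rw [min_mul_of_nonneg _ _ (hout0 z)]
    refine le_min ?_ ?_
    · rw [← (hν.balance z).tsum_eq]
      exact (hcol z).tsum_le_tsum (fun u => mul_le_mul_of_nonneg_right (hleν u) (hq u z))
        (hν.balance z).summable
    · rw [← (hcπ z).tsum_eq]
      exact (hcol z).tsum_le_tsum (fun u => mul_le_mul_of_nonneg_right (hle u) (hq u z))
        (hcπ z).summable
  have hflow : Summable fun z => h z * ∑' u, q z u :=
    Summable.of_nonneg_of_le (fun z => mul_nonneg (h0 z) (hout0 z))
      (fun z => by
        rw [← mul_assoc]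
        exact mul_le_mul_of_nonneg_right (hle z) (hout0 z)) (hsum.mul_left c)
  have hprod : Summable fun p : X × X => h p.1 * q p.1 p.2 := by
    rw [summable_prod_of_nonneg fun p => mul_nonneg (h0 _) (hq _ _)]
    dsimp only
    refine ⟨fun z => (hout z).mul_left _, ?_⟩
    simpa only [tsum_mul_left] using hflow
  have hcomm : ∑' z, ∑' u, h u * q u z = ∑' z, h z * ∑' u, q z u := by
    simp only [← tsum_mul_left]
    exact Summable.tsum_comm (f := fun u z => h u * q u z) hprod
  have hinsum : Summable fun z => ∑' u, h u * q u z := hprod.prod_symm.prod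
  have hD : HasSum (fun z => h z * (∑' u, q z u) - ∑' u, h u * q u z) 0 := by
    have := hflow.hasSum.sub hinsum.hasSum
    rwa [hcomm, sub_self] at this
  have hDx := congrFun ((hasSum_zero_iff_of_nonneg fun z => sub_nonneg.2 (hin z)).1 hD) x
  have hhx : h x = c * π x := by
    rw [hh, hc]
    simp [div_mul_cancel₀ _ (hpos x).ne']
  -- At `x` the functions `h` and `c * π` agree and both are balanced, so their inflows into `x`
  -- agree term by term; the term of `y` has positive rate.
  have hE : HasSum (fun u => c * π u * q u x - h u * q u x) 0 := by
    have := (hcπ x).sub (hcol x).hasSum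
    rwa [← hhx, show h x * (∑' u, q x u) - ∑' u, h u * q u x = 0 from hDx] at this
  have hEy := congrFun ((hasSum_zero_iff_of_nonneg fun u => sub_nonneg.2
    (mul_le_mul_of_nonneg_right (hle u) (hq u x))).1 hE) y
  have hhy : h y = c * π y := by
    have : (c * π y - h y) * q y x = 0 := by rw [sub_mul]; exact hEy
    rcases mul_eq_zero.1 this with h1 | h1
    · linarith
    · exact absurd h1 hyx.ne'
  rw [le_div_iff₀ (hpos y), ← hhy]
  exact hleν y

/-! ### Product of Poisson laws and open Jackson networks -/

section Jackson

variable {N : ℕ}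

/-- The product of the Poisson laws with means `w j`. -/
noncomputable def poissonProduct (w : Fin N → ℝ) (x : Fin N → ℕ) : ℝ :=
  ∏ j, Real.exp (-w j) * w j ^ x j / (x j)!

theorem poissonProduct_pos {w : Fin N → ℝ} (hw : ∀ j, 0 < w j) (x : Fin N → ℕ) :
    0 < poissonProduct w x :=
  Finset.prod_pos fun j _ => by have := hw j; positivity

theorem poissonProduct_add_single (w : Fin N → ℝ) (x : Fin N → ℕ) (j : Fin N) :
    poissonProduct w (x + Pi.single j 1) * (x j + 1) = w j * poissonProduct w x := by
  unfold poissonProduct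
  rw [← Finset.mul_prod_erase _ _ (Finset.mem_univ j),
    ← Finset.mul_prod_erase (a := j) _ _ (Finset.mem_univ j)]
  have : ∏ i ∈ Finset.univ.erase j, Real.exp (-w i) * w i ^ (x + Pi.single j 1 : Fin N → ℕ) i /
      ((x + Pi.single j 1 : Fin N → ℕ) i)! =
      ∏ i ∈ Finset.univ.erase j, Real.exp (-w i) * w i ^ x i / (x i)! :=
    Finset.prod_congr rfl fun i hi => by simp [Finset.ne_of_mem_erase hi]
  rw [this]
  simp only [Pi.add_apply, Pi.single_eq_same, Nat.factorial_succ, Nat.cast_mul, Nat.cast_add,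
    Nat.cast_one]
  have h1 : ((x j)! : ℝ) ≠ 0 := by positivity
  have h2 : (x j + 1 : ℝ) ≠ 0 := by positivity
  field_simp
  ring

theorem hasSum_poissonProduct (w : Fin N → ℝ) (hw : 0 ≤ w) :
    HasSum (poissonProduct w) 1 := by
  lift w to Fin N → NNReal using hw
  have h : ∀ x, poissonProduct (fun j => (w j : ℝ)) x =
      (Measure.pi fun j => poissonMeasure (w j)).real {x} := fun x => by
    simp [poissonProduct, measureReal_def, Measure.pi_singleton, ENNReal.toReal_prod,
      ← poissonMeasure_real_singleton]
  have hsum := (Measure.pi fun j => poissonMeasure (w j)).tsum_indicator_apply_singleton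
    Set.univ MeasurableSet.univ
  simp only [Set.indicator_univ, measure_univ] at hsum
  have := ENNReal.hasSum_toReal (f := fun x => (Measure.pi fun j => poissonMeasure (w j)) {x})
    (by rw [hsum]; exact ENNReal.one_ne_top)
  rw [← ENNReal.tsum_toReal_eq (fun x => measure_ne_top _ _), hsum, ENNReal.toReal_one] at this
  exact this.congr_fun h

/-- States with `x j = 0` contribute nothing; shifting the others by one unit turns the sum into `w
j` times the total mass. This makes the mean exit rate finite, as the uniqueness argument requires.
-/
theorem summable_poissonProduct_mul (w : Fin N → ℝ) (hw : 0 ≤ w) (j : Fin N) :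
    Summable fun x => poissonProduct w x * x j := by
  have hinj : Function.Injective fun x : Fin N → ℕ => x + Pi.single j 1 :=
    add_left_injective _
  rw [← hinj.summable_iff]
  · have : Summable fun x => w j * poissonProduct w x :=
      (hasSum_poissonProduct w hw).summable.mul_left _
    refine this.congr fun x => ?_
    rw [← poissonProduct_add_single]
    simp
  · intro x hx
    have : x j = 0 := by
      by_contra h
      refine hx ⟨x - Pi.single j 1, ?_⟩
      ext i
      by_cases hi : i = j
      · subst hi; simp; omega
      · simp [hi]
    simp [this]

end Jackson

/-! ### Open Jackson networks: balance equations and uniqueness -/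

section Jackson

variable {N : ℕ}

open Classical in
theorem hasSum_ite_add_eq (u e : Fin N → ℕ) (F : (Fin N → ℕ) → ℝ) :
    HasSum (fun x => if u = x + e then F x else 0) (if e ≤ u then F (u - e) else 0) := by
  by_cases h : e ≤ u
  · rw [if_pos h]
    convert hasSum_single (u - e) (f := fun x => if u = x + e then F x else 0) ?_ using 1
    · rw [if_pos (tsub_add_cancel_of_le h).symm]
    · intro x hx
      rw [if_neg]
      rintro rfl
      exact hx (by simp)
  · rw [if_neg h]
    convert hasSum_zero using 2 with x
    rw [if_neg]
    rintro rfl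
    exact h (le_add_of_nonneg_left zero_le)

variable {a m : Fin N → ℝ} {r : Fin N → Fin N → ℝ} {d : Fin N → ℝ}

theorem jacksonRate_nonneg (ha : 0 ≤ a) (hm : 0 ≤ m) (hr : 0 ≤ r) (hd : 0 ≤ d)
    (x y : Fin N → ℕ) : 0 ≤ jacksonRate a m r d x y := by
  unfold jacksonRate
  have h1 := fun j => ha j
  have h2 := fun j => hm j
  have h3 := fun j k => hr j k
  have h4 := fun j => hd j
  simp only [Pi.zero_apply] at h1 h2 h3 h4
  refine add_nonneg (add_nonneg (Finset.sum_nonneg fun j _ => ?_)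
    (Finset.sum_nonneg fun j _ => Finset.sum_nonneg fun k _ => ?_))
    (Finset.sum_nonneg fun j _ => ?_) <;> split_ifs
  · exact h1 j
  · rfl
  · exact mul_nonneg (mul_nonneg (Nat.cast_nonneg _) (h2 j)) (h3 j k)
  · rfl
  · exact mul_nonneg (mul_nonneg (Nat.cast_nonneg _) (h2 j)) (h4 j)
  · rfl

theorem hasSum_jacksonRate (hrd : ∀ j, ∑ k, r j k + d j = 1) (x : Fin N → ℕ) :
    HasSum (jacksonRate a m r d x) (∑ j, a j + ∑ j, x j * m j) := by
  have key : ∀ (j : Fin N) (e : Fin N → ℕ) (c : ℝ),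
      HasSum (fun y : Fin N → ℕ => if y + Pi.single j 1 = x + e then x j * m j * c else 0)
        (x j * m j * c) := by
    intro j e c
    have h := hasSum_ite_add_eq (x + e) (Pi.single j 1) fun _ => x j * m j * c
    simp only [eq_comm (a := x + e)] at h
    convert h using 1
    -- If queue `j` is empty, a target state `y` may fail to exist, but the factor `x j` is then
    -- zero.
    by_cases hx : x j = 0
    · simp [hx]
    · rw [if_pos]
      intro i
      by_cases hi : i = j
      · subst hi; simp; omega
      · simp [hi]
  have h1 : HasSum (fun y => ∑ j, if y = x + Pi.single j 1 then a j else 0) (∑ j, a j) :=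
    hasSum_sum fun j _ => by
      convert hasSum_ite_eq (x + Pi.single j 1) (a j) using 1
  have h2 : HasSum (fun y => ∑ j, ∑ k, if y + Pi.single j 1 = x + Pi.single k 1 then
      x j * m j * r j k else 0) (∑ j, ∑ k, x j * m j * r j k) :=
    hasSum_sum fun j _ => hasSum_sum fun k _ => key j _ _
  have h3 : HasSum (fun y => ∑ j, if y + Pi.single j 1 = x then x j * m j * d j else 0)
      (∑ j, x j * m j * d j) :=
    hasSum_sum fun j _ => by simpa using key j 0 (d j)
  convert (h1.add h2).add h3 using 1
  · rfl
  rw [add_assoc]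
  congr 1
  rw [← Finset.sum_add_distrib]
  refine Finset.sum_congr rfl fun j _ => ?_
  rw [← Finset.mul_sum, ← mul_add, hrd, mul_one]

open Classical in
theorem poissonProduct_sub_single {w : Fin N → ℝ} (hw : ∀ j, 0 < w j) (x : Fin N → ℕ)
    (j : Fin N) :
    (if Pi.single j 1 ≤ x then poissonProduct w (x - Pi.single j 1) else 0) =
      poissonProduct w x * x j / w j := by
  split_ifs with h
  · have := poissonProduct_add_single w (x - Pi.single j 1) j
    have hx : 1 ≤ x j := by simpa using h j
    rw [tsub_add_cancel_of_le h] at this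
    rw [eq_div_iff (hw j).ne', mul_comm _ (w j), ← this]
    simp [Nat.cast_sub hx]
  · have : x j = 0 := by
      by_contra hx
      refine h fun i => ?_
      by_cases hi : i = j
      · subst hi; simp; omega
      · simp [hi]
    simp [this]

/-- Relative to the weight of `y`, a predecessor `y - e_k + e_j` contributes `y k / w k * (w j * m j
* r j k)`. The traffic equation of queue `k` collects the arrivals and moves into `k` to `y k * m
k`, the rate of service at `k`; the departures that lead to `y` add up to the total arrival rate by
`hexit`. -/
theorem hasSum_poissonProduct_mul_jacksonRate {w : Fin N → ℝ} (hw : ∀ j, 0 < w j)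
    (htraffic : ∀ k, a k + ∑ j, w j * m j * r j k = w k * m k)
    (hexit : ∑ j, w j * m j * d j = ∑ j, a j) (y : Fin N → ℕ) :
    HasSum (fun x => poissonProduct w x * jacksonRate a m r d x y)
      (poissonProduct w y * (∑ j, a j + ∑ j, y j * m j)) := by
  have h1 : HasSum (fun x => ∑ j, if y = x + Pi.single j 1 then poissonProduct w x * a j else 0)
      (∑ j, poissonProduct w y * y j / w j * a j) := hasSum_sum fun j _ => by
    convert hasSum_ite_add_eq y (Pi.single j 1) fun x => poissonProduct w x * a j using 1
    rw [← poissonProduct_sub_single hw]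
    split_ifs <;> simp
  have h2 : HasSum (fun x => ∑ j, ∑ k, if y + Pi.single j 1 = x + Pi.single k 1 then
      poissonProduct w x * (x j * m j * r j k) else 0)
      (∑ j, ∑ k, poissonProduct w y * y k / w k * (w j * m j * r j k)) :=
    hasSum_sum fun j _ => hasSum_sum fun k _ => by
      convert hasSum_ite_add_eq (y + Pi.single j 1) (Pi.single k 1)
        fun x => poissonProduct w x * (x j * m j * r j k) using 1
      rw [← poissonProduct_sub_single hw]
      by_cases hk : Pi.single k 1 ≤ y
      · rw [if_pos hk, if_pos (hk.trans (le_add_of_nonneg_right zero_le)),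
          tsub_add_eq_add_tsub hk |>.symm]
        have := poissonProduct_add_single w (y - Pi.single k 1) j
        simp only [Pi.add_apply, Pi.single_eq_same, Nat.cast_add, Nat.cast_one]
        linear_combination (-(m j * r j k)) * this
      · rw [if_neg hk, zero_mul]
        have hyk : y k = 0 := by
          by_contra hx
          refine hk fun i => ?_
          by_cases hi : i = k
          · subst hi; simp; omega
          · simp [hi]
        -- With `y k = 0` there is no predecessor unless `k = j`, where the predecessor is `y`
        -- itself and its rate has the factor `y k = 0`.
        by_cases hjk : k = j
        · subst hjk; simp [hyk]
        · rw [if_neg]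
          intro h
          have := h k
          simp [hyk, hjk] at this
  have h3 : HasSum (fun x => ∑ j, if y + Pi.single j 1 = x then
      poissonProduct w x * (x j * m j * d j) else 0)
      (∑ j, poissonProduct w y * (w j * m j * d j)) := hasSum_sum fun j _ => by
    have h := hasSum_ite_add_eq (y + Pi.single j 1) 0
      fun x => poissonProduct w x * (x j * m j * d j)
    simp only [add_zero, zero_le, if_true, tsub_zero] at h
    convert h using 1
    have := poissonProduct_add_single w y j
    simp only [Pi.add_apply, Pi.single_eq_same, Nat.cast_add, Nat.cast_one]
    linear_combination (-(m j * d j)) * this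
  convert (h1.add h2).add h3 using 1
  · ext x
    simp only [jacksonRate, mul_add, Finset.mul_sum, mul_ite, mul_zero]
  · have hk : ∀ k, poissonProduct w y * y k / w k * a k +
        ∑ j, poissonProduct w y * y k / w k * (w j * m j * r j k) =
        poissonProduct w y * (y k * m k) := fun k => by
      rw [← Finset.mul_sum, ← mul_add, htraffic]
      have := (hw k).ne'
      field_simp
    have hs := Finset.sum_congr (s₁ := Finset.univ) rfl fun k _ => hk k
    rw [Finset.sum_add_distrib, ← Finset.mul_sum] at hs
    rw [← Finset.mul_sum, hexit, Finset.sum_comm (f := fun j k => poissonProduct w y * y k / w k *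
      (w j * m j * r j k)), hs]
    ring

theorem isStationaryDistribution_poissonProduct {w : Fin N → ℝ} (hw : ∀ j, 0 < w j)
    (hrd : ∀ j, ∑ k, r j k + d j = 1)
    (htraffic : ∀ k, a k + ∑ j, w j * m j * r j k = w k * m k)
    (hexit : ∑ j, w j * m j * d j = ∑ j, a j) :
    IsStationaryDistribution (jacksonRate a m r d) (poissonProduct w) where
  nonneg x := (poissonProduct_pos hw x).le
  hasSum_one := hasSum_poissonProduct w fun j => (hw j).le
  balance y := by
    rw [(hasSum_jacksonRate hrd y).tsum_eq]
    exact hasSum_poissonProduct_mul_jacksonRate hw htraffic hexit y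

theorem jacksonRate_arrival_pos (ha : 0 ≤ a) (hm : 0 ≤ m) (hr : 0 ≤ r) (hd : 0 ≤ d)
    (x : Fin N → ℕ) {j : Fin N} (hj : 0 < a j) :
    0 < jacksonRate a m r d x (x + Pi.single j 1) := by
  unfold jacksonRate
  have h2 := fun j => hm j
  have h3 := fun j k => hr j k
  have h4 := fun j => hd j
  simp only [Pi.zero_apply] at h2 h3 h4
  refine add_pos_of_pos_of_nonneg (add_pos_of_pos_of_nonneg
    (Finset.sum_pos' (fun i _ => ?_) ⟨j, Finset.mem_univ _, by simpa using hj⟩)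
    (Finset.sum_nonneg fun j _ => Finset.sum_nonneg fun k _ => ?_))
    (Finset.sum_nonneg fun j _ => ?_)
  · split_ifs
    exacts [ha i, le_rfl]
  · split_ifs
    exacts [mul_nonneg (mul_nonneg (Nat.cast_nonneg _) (h2 j)) (h3 j k), le_rfl]
  · split_ifs
    exacts [mul_nonneg (mul_nonneg (Nat.cast_nonneg _) (h2 j)) (h4 j), le_rfl]

theorem jacksonRate_move_pos (ha : 0 ≤ a) (hm : 0 ≤ m) (hr : 0 ≤ r) (hd : 0 ≤ d)
    (x : Fin N → ℕ) {j k : Fin N} (hj : 0 < m j) (hjk : 0 < r j k) :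
    0 < jacksonRate a m r d (x + Pi.single j 1) (x + Pi.single k 1) := by
  unfold jacksonRate
  have h2 := fun j => hm j
  have h3 := fun j k => hr j k
  have h4 := fun j => hd j
  simp only [Pi.zero_apply] at h2 h3 h4
  have hterm : ∀ i l (y z u v : Fin N → ℕ), (0 : ℝ) ≤
      if y + z = u + v then ((x + Pi.single j 1 : Fin N → ℕ) i : ℝ) * m i * r i l else 0 := by
    intro i l y z u v
    split_ifs
    exacts [mul_nonneg (mul_nonneg (Nat.cast_nonneg _) (h2 i)) (h3 i l), le_rfl]
  refine add_pos_of_pos_of_nonneg (add_pos_of_nonneg_of_pos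
    (Finset.sum_nonneg fun i _ => ?_)
    (Finset.sum_pos' (fun i _ => Finset.sum_nonneg fun l _ => hterm _ _ _ _ _ _)
      ⟨j, Finset.mem_univ _, Finset.sum_pos' (fun l _ => hterm _ _ _ _ _ _)
        ⟨k, Finset.mem_univ _, ?_⟩⟩))
    (Finset.sum_nonneg fun j _ => ?_)
  · split_ifs
    exacts [ha i, le_rfl]
  · rw [if_pos (by abel)]
    simp only [Pi.add_apply, Pi.single_eq_same, Nat.cast_add, Nat.cast_one]
    positivity
  · split_ifs
    exacts [mul_nonneg (mul_nonneg (Nat.cast_nonneg _) (h2 j)) (h4 j), le_rfl]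

theorem jacksonRate_departure_pos (ha : 0 ≤ a) (hm : 0 ≤ m) (hr : 0 ≤ r) (hd : 0 ≤ d)
    (x : Fin N → ℕ) {j : Fin N} (hj : 0 < m j) (hdj : 0 < d j) :
    0 < jacksonRate a m r d (x + Pi.single j 1) x := by
  unfold jacksonRate
  have h2 := fun j => hm j
  have h3 := fun j k => hr j k
  have h4 := fun j => hd j
  simp only [Pi.zero_apply] at h2 h3 h4
  refine add_pos_of_nonneg_of_pos (add_nonneg
    (Finset.sum_nonneg fun i _ => ?_)
    (Finset.sum_nonneg fun j _ => Finset.sum_nonneg fun k _ => ?_))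
    (Finset.sum_pos' (fun i _ => ?_) ⟨j, Finset.mem_univ _, ?_⟩)
  · split_ifs
    exacts [ha i, le_rfl]
  · split_ifs
    exacts [mul_nonneg (mul_nonneg (Nat.cast_nonneg _) (h2 j)) (h3 j k), le_rfl]
  · split_ifs
    exacts [mul_nonneg (mul_nonneg (Nat.cast_nonneg _) (h2 i)) (h4 i), le_rfl]
  · rw [if_pos rfl]
    simp only [Pi.add_apply, Pi.single_eq_same, Nat.cast_add, Nat.cast_one]
    positivity

/-- The stationary distribution of a line of queues is unique, if every queue passes units on to
the next one with positive probability. -/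
theorem isStationaryDistribution_jacksonRate_iff {n : ℕ} {a m d w : Fin (n + 1) → ℝ}
    {r : Fin (n + 1) → Fin (n + 1) → ℝ} (hw : ∀ j, 0 < w j) (ha : 0 ≤ a) (hm : ∀ j, 0 < m j)
    (hr : 0 ≤ r) (hd : 0 ≤ d) (hrd : ∀ j, ∑ k, r j k + d j = 1)
    (htraffic : ∀ k, a k + ∑ j, w j * m j * r j k = w k * m k)
    (hexit : ∑ j, w j * m j * d j = ∑ j, a j)
    (ha0 : 0 < a 0) (hnext : ∀ i : Fin n, 0 < r i.castSucc i.succ) (hlast : 0 < d (Fin.last n))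
    (ν : (Fin (n + 1) → ℕ) → ℝ) :
    IsStationaryDistribution (jacksonRate a m r d) ν ↔ ν = poissonProduct w := by
  have hm' : 0 ≤ m := fun j => (hm j).le
  have hπ := isStationaryDistribution_poissonProduct hw hrd htraffic hexit
  refine ⟨fun hν => ?_, fun h => h ▸ hπ⟩
  have hpos := poissonProduct_pos hw
  have hsum : Summable fun x => poissonProduct w x * ∑' z, jacksonRate a m r d x z := by
    simp only [(hasSum_jacksonRate hrd _).tsum_eq, mul_add]
    refine (hπ.hasSum_one.summable.mul_right _).add ?_
    simp only [Finset.mul_sum]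
    refine summable_sum fun j _ => ?_
    simp only [← mul_assoc]
    exact (summable_poissonProduct_mul w (fun j => (hw j).le) j).mul_right _
  have hratio {x y} := hπ.div_le_div (x := x) (y := y) (jacksonRate_nonneg ha hm' hr hd)
    (fun x => (hasSum_jacksonRate hrd x).summable) hpos hsum hν
  set f := fun x => ν x / poissonProduct w x with hf
  have hstep : ∀ x j, f (x + Pi.single j 1) = f x := by
    intro x j
    -- The cycle is arrival at queue `0`, moves down the line, departure from the last queue; `f`
    -- does not increase along it, so it is constant on it.
    have hanti : Antitone fun j => f (x + Pi.single j 1) := Fin.antitone_iff_succ_le.2 fun i =>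
      hratio (jacksonRate_move_pos ha hm' hr hd x (hm _) (hnext i))
    refine le_antisymm ((hanti (Fin.zero_le j)).trans ?_) (le_trans ?_ (hanti (Fin.le_last j)))
    · exact hratio (jacksonRate_arrival_pos ha hm' hr hd x ha0)
    · exact hratio (jacksonRate_departure_pos ha hm' hr hd x (hm _) hlast)
  have hconst : ∀ k x, ∑ j, x j = k → f x = f 0 := by
    intro k
    induction k with
    | zero =>
      intro x hx
      congr 1
      ext j
      exact Finset.sum_eq_zero_iff.1 hx j (Finset.mem_univ j)
    | succ k ih =>
      intro x hx
      obtain ⟨j, hj⟩ : ∃ j, x j ≠ 0 := by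
        by_contra! h
        simp [h] at hx
      have hle : Pi.single j 1 ≤ x := by
        intro i
        by_cases hi : i = j
        · subst hi; simp; omega
        · simp [hi]
      rw [← tsub_add_cancel_of_le hle, hstep]
      refine ih _ ?_
      have : ∑ i, (x - Pi.single j 1 + Pi.single j 1 : Fin (n + 1) → ℕ) i = k + 1 := by
        rw [tsub_add_cancel_of_le hle, hx]
      simpa [Finset.sum_add_distrib] using this
  have hν' : ∀ x, ν x = f 0 * poissonProduct w x := fun x => by
    rw [← hconst _ x rfl, hf]
    exact (div_mul_cancel₀ _ (hpos x).ne').symm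
  have h1 := (hπ.hasSum_one.mul_left (f 0)).unique (hν.hasSum_one.congr_fun fun x => (hν' x).symm)
  ext x
  rw [hν', show f 0 = 1 by simpa using h1, one_mul]

end Jackson

/-! ### Stage probabilities of a session and the traffic equations -/

section Session

variable {N : ℕ}

theorem measurable_entryAge (j : Fin N) : Measurable fun s : Session N => entryAge s j := by
  unfold entryAge
  fun_prop

theorem measurable_holdingTime (j : Fin N) : Measurable fun s : Session N => holdingTime s j := by
  have := measurable_entryAge j
  unfold holdingTime
  fun_prop

theorem measurableSet_reaches (j : Fin N) : MeasurableSet {s : Session N | Reaches s j} := by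
  have := measurable_entryAge j
  unfold Reaches
  exact (MeasurableSet.const _).union (measurableSet_lt this measurable_fst)

variable (μ : Measure (Session N))

/-- The probability that a session has a stage with number `k`. -/
noncomputable def reachProb (k : ℕ) : ℝ :=
  if h : k < N then μ.real {s | Reaches s ⟨k, h⟩} else 0

theorem reachProb_coe (j : Fin N) : reachProb μ j = μ.real {s | Reaches s j} := by
  simp [reachProb]

/-- Ending at stage `k` means reaching `k` but not `k + 1`, and nonnegative dwell times make these
events nested almost surely. The value `0` of `reachProb` past the route covers the last stage, so
sums of `lastProb` telescope. -/
theorem lastProb_eq [IsProbabilityMeasure μ] (hτ : ∀ᵐ s ∂μ, ∀ j, 0 ≤ s.2 j) (k : Fin N) :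
    lastProb μ k = reachProb μ k - reachProb μ (k + 1) := by
  have hR : ∀ (s : Session N) (j : Fin N), Reaches s j ↔ ((j : ℕ) ≠ 0 → entryAge s j < s.1) :=
    fun s j => by unfold Reaches; tauto
  rw [reachProb_coe]
  by_cases hk : (k : ℕ) + 1 < N
  · have hIic : Finset.Iic k = Finset.Iio (⟨k + 1, hk⟩ : Fin N) := by
      ext i
      simp only [Finset.mem_Iic, Finset.mem_Iio, Fin.le_def, Fin.lt_def]
      omega
    have hlast : {s : Session N | IsLastStage s k} =
        {s | Reaches s k} \ {s | Reaches s ⟨k + 1, hk⟩} := by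
      ext s
      simp only [IsLastStage, hIic, Set.mem_ofPred_eq, Set.mem_sdiff, hR, entryAge]
      have : (k : ℕ) + 1 ≠ N := by omega
      simp [this]
    have hsub : ({s | Reaches s ⟨k + 1, hk⟩} : Set (Session N)) ≤ᵐ[μ] {s | Reaches s k} := by
      filter_upwards [hτ] with s hs h
      change Reaches s _ at h
      change Reaches s _
      rw [hR] at h ⊢
      refine fun _ => lt_of_le_of_lt ?_ (h (by simp))
      refine Finset.sum_le_sum_of_subset_of_nonneg (fun i => ?_) fun i _ _ => hs i
      simp only [Finset.mem_Iio, Fin.lt_def]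
      omega
    have hinter : ({s | Reaches s k} ∩ {s | Reaches s ⟨k + 1, hk⟩} : Set (Session N)) =ᵐ[μ]
        {s | Reaches s ⟨k + 1, hk⟩} := by
      filter_upwards [hsub] with s hs
      exact propext ⟨fun h => h.2, fun h => ⟨hs h, h⟩⟩
    rw [lastProb, hlast, reachProb, dif_pos hk, ← measureReal_congr hinter,
      eq_sub_iff_add_eq, measureReal_sdiff_add_inter (measurableSet_reaches _)]
  · have hN : (k : ℕ) + 1 = N := by omega
    rw [reachProb, dif_neg hk, sub_zero, lastProb]
    congr 1
    ext s
    simp only [IsLastStage, Set.mem_ofPred_eq, hR, entryAge]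
    simp [hN]

variable [IsProbabilityMeasure μ]

theorem reachProb_zero (hN : 1 ≤ N) : reachProb μ 0 = 1 := by
  rw [reachProb, dif_pos (by omega)]
  simp [Reaches]

theorem sum_lastProb_Iio (hτ : ∀ᵐ s ∂μ, ∀ j, 0 ≤ s.2 j) (hN : 1 ≤ N) (j : Fin N) :
    ∑ n ∈ Finset.Iio j, lastProb μ n = 1 - reachProb μ j := by
  have h : ∑ n ∈ Finset.Iio j, lastProb μ n =
      ∑ n ∈ (Finset.Iio j).map Fin.valEmbedding, (reachProb μ n - reachProb μ (n + 1)) := by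
    rw [Finset.sum_map]
    exact Finset.sum_congr rfl fun n _ => lastProb_eq μ hτ n
  rw [h, Fin.map_valEmbedding_Iio, Nat.Iio_eq_range, Finset.sum_range_sub', reachProb_zero μ hN]

theorem sum_lastProb (hτ : ∀ᵐ s ∂μ, ∀ j, 0 ≤ s.2 j) (hN : 1 ≤ N) :
    ∑ n, lastProb μ n = 1 := by
  rw [Finset.sum_congr rfl fun n _ => lastProb_eq μ hτ n,
    Fin.sum_univ_eq_sum_range (fun n => reachProb μ n - reachProb μ (n + 1)),
    Finset.sum_range_sub', reachProb_zero μ hN, reachProb, dif_neg (lt_irrefl N), sub_zero]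

theorem sum_lastProb_Ici (hτ : ∀ᵐ s ∂μ, ∀ j, 0 ≤ s.2 j) (hN : 1 ≤ N) (j : Fin N) :
    ∑ n ∈ Finset.Ici j, lastProb μ n = reachProb μ j := by
  have h := Finset.sum_add_sum_compl (Finset.Iio j) (lastProb μ)
  have hc : (Finset.Iio j)ᶜ = Finset.Ici j := by ext i; simp
  rw [hc, sum_lastProb μ hτ hN, sum_lastProb_Iio μ hτ hN] at h
  linarith

theorem load_eq_reachProb (lam : ℝ) (hτ : ∀ᵐ s ∂μ, ∀ j, 0 ≤ s.2 j) (hN : 1 ≤ N) (j : Fin N) :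
    load lam μ j = lam * reachProb μ j * meanHolding μ j := by
  rw [load, sum_lastProb_Iio μ hτ hN, sub_sub_cancel]

/-- The probability of reaching stage `j` cancels the normalization of the conditional mean. -/
theorem load_eq_setIntegral (lam : ℝ) (hτ : ∀ᵐ s ∂μ, ∀ j, 0 ≤ s.2 j) (hN : 1 ≤ N)
    (j : Fin N) (hj : 0 < μ {s | Reaches s j}) :
    load lam μ j = lam * ∫ s in {s | Reaches s j}, holdingTime s j ∂μ := by
  have hpos : μ.real {s | Reaches s j} ≠ 0 :=
    (ENNReal.toReal_pos hj.ne' (measure_ne_top _ _)).ne'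
  rw [load_eq_reachProb μ lam hτ hN, reachProb_coe, meanHolding, ProbabilityTheory.cond,
    integral_smul_measure, ENNReal.toReal_inv, ← measureReal_def, smul_eq_mul, mul_assoc,
    mul_inv_cancel_left₀ hpos]

/-- The product of the Poisson laws with means `w j` is the unique stationary distribution of the
memoryless network. -/
theorem isStationaryDistribution_memorylessRate_iff (hN : 1 ≤ N) {lam : ℝ} (hlam : 0 < lam)
    (hτ : ∀ᵐ s ∂μ, ∀ j, 0 ≤ s.2 j) (hreach : ∀ j, 0 < μ {s | Reaches s j})
    (hmean : ∀ j, 0 < meanHolding μ j) (ν : (Fin N → ℕ) → ℝ) :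
    IsStationaryDistribution (memorylessRate lam μ) ν ↔ ν = poissonProduct (load lam μ) := by
  obtain ⟨n, rfl⟩ : ∃ n, N = n + 1 := ⟨N - 1, by omega⟩
  have hρ : ∀ j : Fin (n + 1), 0 < reachProb μ j := fun j => by
    rw [reachProb_coe]
    exact ENNReal.toReal_pos (hreach j).ne' (measure_ne_top _ _)
  have hlast : lastProb μ (Fin.last n) = reachProb μ (Fin.last n) := by
    rw [lastProb_eq μ hτ, sub_eq_self, reachProb, dif_neg (by simp)]
  have hp : ∀ j, 0 ≤ lastProb μ j := fun j => measureReal_nonneg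
  unfold memorylessRate
  simp only [sum_lastProb_Ici μ hτ hN]
  have hwm : ∀ j, load lam μ j * (1 / meanHolding μ j) = lam * reachProb μ j := fun j => by
    rw [load_eq_reachProb μ lam hτ hN, mul_one_div, mul_div_cancel_right₀ _ (hmean j).ne']
  refine isStationaryDistribution_jacksonRate_iff (fun j => ?_) (fun j => ?_)
    (fun j => one_div_pos.2 (hmean j)) (fun j k => ?_) (fun j => ?_) (fun j => ?_) (fun k => ?_)
    ?_ ?_ (fun i => ?_) ?_ ν
  · rw [load_eq_reachProb μ lam hτ hN]
    exact mul_pos (mul_pos hlam (hρ j)) (hmean j)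
  · dsimp only
    split_ifs
    exacts [hlam.le, le_rfl]
  · dsimp only
    split_ifs
    exacts [div_nonneg (hρ k).le (hρ j).le, le_rfl]
  · exact div_nonneg (hp j) (hρ j).le
  · induction j using Fin.lastCases with
    | last =>
      rw [Finset.sum_eq_zero fun k _ => if_neg (by have := k.2; simp; omega), zero_add, hlast,
        div_self (hρ _).ne']
    | cast i =>
      rw [Finset.sum_eq_single i.succ, if_pos (by simp), ← add_div, lastProb_eq μ hτ]
      · simpa using div_self (hρ i.castSucc).ne'
      · intro k _ hk
        rw [if_neg]
        contrapose! hk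
        ext
        simpa using hk
      · simp
  · simp only [hwm]
    induction k using Fin.cases with
    | zero => simp [reachProb_zero μ hN]
    | succ i =>
      rw [Finset.sum_eq_single i.castSucc, if_neg (by simp),
        if_pos (show (i.succ : ℕ) = i.castSucc + 1 by simp), zero_add]
      · have := (hρ i.castSucc).ne'
        field_simp
      · intro k _ hk
        rw [if_neg, mul_zero]
        contrapose! hk
        ext
        simpa using hk.symm
      · simp
  · simp only [hwm]
    have : ∀ j : Fin (n + 1), lam * reachProb μ j * (lastProb μ j / reachProb μ j) =
        lam * lastProb μ j := fun j => by
      have := (hρ j).ne'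
      field_simp
    rw [Finset.sum_congr rfl fun j _ => this j, ← Finset.mul_sum, sum_lastProb μ hτ hN,
      Finset.sum_eq_single 0] <;> simp +contextual
  · simpa using hlam
  · rw [if_pos (by simp)]
    exact div_pos (hρ _) (hρ _)
  · rw [hlast]
    exact div_pos (hρ _) (hρ _)

end Session

/-! ### Poisson weights as functions of the mean -/

/-- The weight of `k` under the Poisson law with mean `w`; it is zero for negative `k`. -/
noncomputable def poissonWeight (w : ℝ) (k : ℤ) : ℝ :=
  if 0 ≤ k then Real.exp (-w) * w ^ k.toNat / (k.toNat)! else 0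

theorem poissonWeight_of_neg (w : ℝ) {k : ℤ} (hk : k < 0) : poissonWeight w k = 0 :=
  if_neg (not_le.2 hk)

@[simp]
theorem poissonWeight_natCast (w : ℝ) (n : ℕ) :
    poissonWeight w n = Real.exp (-w) * w ^ n / n ! := by
  simp [poissonWeight]

theorem poissonWeight_nonneg {w : ℝ} (hw : 0 ≤ w) (k : ℤ) : 0 ≤ poissonWeight w k := by
  unfold poissonWeight
  split_ifs <;> positivity

theorem poissonWeight_le_one {w : ℝ} (hw : 0 ≤ w) (k : ℤ) : poissonWeight w k ≤ 1 := by
  unfold poissonWeight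
  split_ifs
  · rw [mul_div_assoc, Real.exp_neg, inv_mul_le_one₀ (Real.exp_pos _)]
    exact Real.pow_div_factorial_le_exp w hw _
  · exact zero_le_one

theorem poissonWeight_zero_right (w : ℝ) : poissonWeight w 0 = Real.exp (-w) := by
  simpa using poissonWeight_natCast w 0

/-- A bound uniform in `k`: it sends the weight of every wrong count to zero as the remaining load
vanishes. -/
theorem poissonWeight_le {w : ℝ} (hw : 0 ≤ w) {k : ℤ} (hk : k ≠ 0) : poissonWeight w k ≤ w := by
  rcases lt_or_gt_of_ne hk with h | h
  · rwa [poissonWeight_of_neg w h]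
  · obtain ⟨n, rfl⟩ : ∃ n : ℕ, k = (n + 1 : ℕ) := ⟨k.toNat - 1, by omega⟩
    have h1 := poissonWeight_le_one hw n
    rw [poissonWeight_natCast] at h1 ⊢
    have h2 : Real.exp (-w) * w ^ (n + 1) / ((n + 1)! : ℕ) =
        Real.exp (-w) * w ^ n / n ! * (w / (n + 1)) := by
      rw [Nat.factorial_succ, pow_succ]
      push_cast
      field_simp
    rw [h2]
    calc _ ≤ 1 * (w / (n + 1)) := by gcongr
      _ ≤ w := by
        rw [one_mul]
        exact div_le_self hw (by linarith [Nat.cast_nonneg (α := ℝ) n])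

/-- The forward equation of the Poisson process. Integer `k` with weight zero below `0` lets one
formula cover all cases, and lets counts overshoot their target. -/
theorem hasDerivAt_poissonWeight (w : ℝ) (k : ℤ) :
    HasDerivAt (fun w => poissonWeight w k) (poissonWeight w (k - 1) - poissonWeight w k) w := by
  rcases lt_trichotomy k 0 with h | rfl | h
  · simp only [poissonWeight_of_neg _ h, poissonWeight_of_neg _ (show k - 1 < 0 by omega), sub_zero]
    exact hasDerivAt_const w 0
  · simp only [poissonWeight_zero_right, poissonWeight_of_neg _ (show (0 : ℤ) - 1 < 0 by omega)]
    simpa using (hasDerivAt_id w).neg.exp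
  · obtain ⟨n, rfl⟩ : ∃ n : ℕ, k = (n + 1 : ℕ) := ⟨k.toNat - 1, by omega⟩
    have hk : ((n + 1 : ℕ) : ℤ) - 1 = (n : ℕ) := by push_cast; ring
    rw [hk]
    simp only [poissonWeight_natCast]
    have h1 : HasDerivAt (fun w : ℝ => Real.exp (-w)) (-Real.exp (-w)) w := by
      simpa using (hasDerivAt_id w).neg.exp
    have h2 := (h1.mul (hasDerivAt_pow (n + 1) w)).div_const ((n + 1)! : ℝ)
    refine h2.congr_deriv ?_
    simp only [Nat.factorial_succ, Nat.add_sub_cancel]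
    push_cast
    field_simp
    ring

theorem continuous_poissonWeight (k : ℤ) : Continuous fun w => poissonWeight w k :=
  continuous_iff_continuousAt.2 fun w => (hasDerivAt_poissonWeight w k).continuousAt

theorem lipschitzOnWith_poissonWeight (k : ℤ) :
    LipschitzOnWith 1 (fun w => poissonWeight w k) (Set.Ici 0) := by
  refine (convex_Ici 0).lipschitzOnWith_of_nnnorm_hasDerivWithin_le
    (fun w _ => (hasDerivAt_poissonWeight w k).hasDerivWithinAt) fun w hw => ?_
  rw [← NNReal.coe_le_coe, coe_nnnorm, Real.norm_eq_abs, abs_le]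
  have h1 := poissonWeight_nonneg hw k
  have h2 := poissonWeight_nonneg hw (k - 1)
  have h3 := poissonWeight_le_one hw k
  have h4 := poissonWeight_le_one hw (k - 1)
  constructor <;> simp <;> linarith

/-! ### Tail loads -/

theorem integral_expMeasure {lam : ℝ} (hlam : 0 < lam) (f : ℝ → ℝ) :
    ∫ v, f v ∂(expMeasure lam) = ∫ v in Set.Ioi 0, lam * Real.exp (-(lam * v)) * f v := by
  have : expMeasure lam = volume.withDensity (exponentialPDF lam) := rfl
  have hm : Measurable (exponentialPDF lam) :=
    (measurable_exponentialPDFReal lam).ennreal_ofReal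
  rw [this, integral_withDensity_eq_integral_toReal_smul hm
    (Eventually.of_forall fun _ => ENNReal.ofReal_lt_top), ← integral_Ici_eq_integral_Ioi,
    ← integral_indicator measurableSet_Ici]
  congr 1 with v
  rw [exponentialPDF_eq]
  by_cases hv : 0 ≤ v
  · rw [if_pos hv, ENNReal.toReal_ofReal (by positivity), Set.indicator_of_mem (Set.mem_Ici.2 hv), smul_eq_mul]
  · rw [if_neg hv, Set.indicator_of_notMem (by simpa using hv)]
    simp

theorem setIntegral_Ioi_comp_add (f : ℝ → ℝ) (a b : ℝ) :
    ∫ v in Set.Ioi b, f (a + v) = ∫ v in Set.Ioi (a + b), f v := by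
  rw [← integral_indicator measurableSet_Ioi, ← integral_indicator measurableSet_Ioi,
    ← integral_add_left_eq_self ((Set.Ioi (a + b)).indicator f) a]
  congr 1 with v
  simp [Set.indicator]

theorem tendsto_setIntegral_Ioi {f : ℝ → ℝ} (hf : Integrable f) :
    Tendsto (fun a => ∫ v in Set.Ioi a, f v) atTop (𝓝 0) := by
  have h := (intervalIntegral_tendsto_integral_Ioi 0 hf.integrableOn tendsto_id).const_sub
    (∫ v in Set.Ioi 0, f v)
  rw [sub_self] at h
  refine h.congr fun a => ?_
  rw [← intervalIntegral.integral_Ioi_sub_Ioi' hf.integrableOn hf.integrableOn, id, sub_sub_cancel]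

theorem absolutelyContinuousOnInterval_prod {κ : Type*} (s : Finset κ) {f : κ → ℝ → ℝ} {a b : ℝ}
    (hf : ∀ i ∈ s, AbsolutelyContinuousOnInterval (f i) a b) :
    AbsolutelyContinuousOnInterval (fun v => ∏ i ∈ s, f i v) a b := by
  classical
  induction s using Finset.induction_on with
  | empty =>
    simp only [Finset.prod_empty]
    exact (LipschitzWith.const 1).lipschitzOnWith.absolutelyContinuousOnInterval
  | insert i s hi ih =>
    simp only [Finset.prod_insert hi]
    exact (hf i (Finset.mem_insert_self i s)).mul
      (ih fun j hj => hf j (Finset.mem_insert_of_mem hj))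

section Tail

variable {ι : Type*} {lam : ℝ} {g : ι → ℝ → ℝ}

/-- The mean number of points after time `a` of a Poisson process with intensity `lam * g j`. -/
noncomputable def tailLoad (lam : ℝ) (g : ι → ℝ → ℝ) (a : ℝ) (j : ι) : ℝ :=
  lam * ∫ v in Set.Ioi a, g j v

theorem tailLoad_nonneg (hlam : 0 < lam) (hg0 : 0 ≤ g) (a : ℝ) : 0 ≤ tailLoad lam g a :=
  fun j => mul_nonneg hlam.le (integral_nonneg (hg0 j))

theorem tailLoad_eq (hgi : ∀ j, Integrable (g j)) (a : ℝ) (j : ι) :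
    tailLoad lam g a j = tailLoad lam g 0 j - lam * ∫ v in (0)..a, g j v := by
  rw [tailLoad, tailLoad, ← intervalIntegral.integral_Ioi_sub_Ioi' (hgi j).integrableOn (hgi j).integrableOn]
  ring

theorem lipschitzWith_tailLoad (hlam : 0 < lam) (hg0 : 0 ≤ g) (hg1 : g ≤ 1)
    (hgi : ∀ j, Integrable (g j)) (j : ι) :
    LipschitzWith lam.toNNReal fun a => tailLoad lam g a j := by
  refine LipschitzWith.of_dist_le_mul fun a b => ?_
  rw [Real.dist_eq, Real.dist_eq, Real.coe_toNNReal _ hlam.le, tailLoad, tailLoad, ← mul_sub,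
    intervalIntegral.integral_Ioi_sub_Ioi' (hgi j).integrableOn (hgi j).integrableOn, abs_mul, abs_of_pos hlam,
    abs_sub_comm a b]
  refine mul_le_mul_of_nonneg_left ?_ hlam.le
  have := intervalIntegral.norm_integral_le_of_norm_le_const (a := a) (b := b) (f := g j) (C := 1)
    fun v _ => by rw [Real.norm_of_nonneg (hg0 j v)]; exact hg1 j v
  simpa only [Real.norm_eq_abs, one_mul] using this

theorem continuous_tailLoad (hlam : 0 < lam) (hg0 : 0 ≤ g) (hg1 : g ≤ 1)
    (hgi : ∀ j, Integrable (g j)) : Continuous (tailLoad lam g) :=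
  continuous_pi fun j => (lipschitzWith_tailLoad hlam hg0 hg1 hgi j).continuous

theorem tendsto_tailLoad (hgi : ∀ j, Integrable (g j)) :
    Tendsto (tailLoad lam g) atTop (𝓝 0) := by
  rw [tendsto_pi_nhds]
  intro j
  simpa [tailLoad] using (tendsto_setIntegral_Ioi (hgi j)).const_mul lam

end Tail

/-! ### Products of Poisson weights and the one-step identity -/

section Product

variable {ι : Type*} [Fintype ι]

/-- The weight of `x` under the product of the Poisson laws with means `w j`. -/
noncomputable def poissonWeights (w : ι → ℝ) (x : ι → ℤ) : ℝ :=
  ∏ j, poissonWeight (w j) (x j)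

theorem poissonWeights_nonneg {w : ι → ℝ} (hw : 0 ≤ w) (x : ι → ℤ) : 0 ≤ poissonWeights w x :=
  Finset.prod_nonneg fun j _ => poissonWeight_nonneg (hw j) _

theorem poissonWeights_le_one {w : ι → ℝ} (hw : 0 ≤ w) (x : ι → ℤ) : poissonWeights w x ≤ 1 :=
  Finset.prod_le_one (fun j _ => poissonWeight_nonneg (hw j) _)
    fun j _ => poissonWeight_le_one (hw j) _

theorem poissonWeights_le {w : ι → ℝ} (hw : 0 ≤ w) {x : ι → ℤ} {j : ι} (hx : x j ≠ 0) :
    poissonWeights w x ≤ w j := by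
  classical
  rw [poissonWeights, ← Finset.mul_prod_erase _ _ (Finset.mem_univ j)]
  have h1 : ∏ i ∈ Finset.univ.erase j, poissonWeight (w i) (x i) ≤ 1 :=
    Finset.prod_le_one (fun j _ => poissonWeight_nonneg (hw j) _)
      fun j _ => poissonWeight_le_one (hw j) _
  calc _ ≤ poissonWeight (w j) (x j) * 1 := by
        gcongr
        exact poissonWeight_nonneg (hw j) _
    _ ≤ w j := by rw [mul_one]; exact poissonWeight_le (hw j) hx

theorem continuous_poissonWeights (x : ι → ℤ) : Continuous fun w : ι → ℝ => poissonWeights w x :=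
  continuous_finsetProd _ fun j _ => (continuous_poissonWeight _).comp (continuous_apply j)

theorem poissonWeights_zero_right (w : ι → ℝ) :
    poissonWeights w 0 = ∏ j, Real.exp (-w j) := by
  simp [poissonWeights, poissonWeight_zero_right]

variable [DecidableEq ι]

theorem poissonWeights_sub_single_sub (w : ι → ℝ) (x : ι → ℤ) (j : ι) :
    poissonWeights w (x - Pi.single j 1) - poissonWeights w x =
      (∏ i ∈ Finset.univ.erase j, poissonWeight (w i) (x i)) *
        (poissonWeight (w j) (x j - 1) - poissonWeight (w j) (x j)) := by
  rw [poissonWeights, poissonWeights, ← Finset.prod_erase_mul _ _ (Finset.mem_univ j),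
    ← Finset.prod_erase_mul (a := j) _ _ (Finset.mem_univ j), mul_sub,
    Finset.prod_congr (g := fun i => poissonWeight (w i) (x i)) rfl fun i hi => by
      simp [Finset.ne_of_mem_erase hi]]
  simp

theorem hasDerivAt_poissonWeights {f : ι → ℝ → ℝ} {f' : ι → ℝ} {v : ℝ} (x : ι → ℤ)
    (hf : ∀ j, HasDerivAt (f j) (f' j) v) :
    HasDerivAt (fun v => poissonWeights (fun j => f j v) x)
      (∑ j, f' j * (poissonWeights (fun j => f j v) (x - Pi.single j 1) -
        poissonWeights (fun j => f j v) x)) v := by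
  unfold poissonWeights
  have h := HasDerivAt.fun_finsetProd (u := Finset.univ)
    (f := fun j v => poissonWeight (f j v) (x j)) (x := v)
    fun j _ => (hasDerivAt_poissonWeight (f j v) (x j)).comp v (hf j)
  refine h.congr_deriv (Finset.sum_congr rfl fun j _ => ?_)
  have := poissonWeights_sub_single_sub (fun j => f j v) x j
  unfold poissonWeights at this
  rw [this, smul_eq_mul]
  ring

/-- The next point comes after an exponential time `v` and is of type `j` with probability `g j v`.
Since the tail load has derivative `-(lam * g j v)` almost everywhere, the forward equation makes
the density times the integrand the derivative of `-exp (-(lam * v)) * Φ x v`. The constant `c`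
leaves room for the load of a second, independent process. -/
theorem integral_exp_mul_poissonWeights_tailLoad {lam : ℝ} {g : ι → ℝ → ℝ} (hlam : 0 < lam) (hg0 : 0 ≤ g) (hg1 : g ≤ 1)
    (hgm : ∀ j, Measurable (g j)) (hgi : ∀ j, Integrable (g j)) {c : ι → ℝ} (hc : 0 ≤ c)
    (x : ι → ℤ) :
    ∫ v, (poissonWeights (c + tailLoad lam g v) x +
      ∑ j, g j v * (poissonWeights (c + tailLoad lam g v) (x - Pi.single j 1) -
        poissonWeights (c + tailLoad lam g v) x)) ∂(expMeasure lam) =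
      poissonWeights (c + tailLoad lam g 0) x := by
  set Φ : (ι → ℤ) → ℝ → ℝ := fun x v => poissonWeights (c + tailLoad lam g v) x with hΦ
  set I : ℝ → ℝ := fun v => Φ x v + ∑ j, g j v * (Φ (x - Pi.single j 1) v - Φ x v) with hI
  change ∫ v, I v ∂(expMeasure lam) = Φ x 0
  have hw : ∀ v, 0 ≤ c + tailLoad lam g v := fun v => add_nonneg hc (tailLoad_nonneg hlam hg0 v)
  have hΦ0 : ∀ x v, 0 ≤ Φ x v := fun x v => poissonWeights_nonneg (hw v) x
  have hΦ1 : ∀ x v, Φ x v ≤ 1 := fun x v => poissonWeights_le_one (hw v) x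
  have hΦc : ∀ x, Continuous (Φ x) := fun x => (continuous_poissonWeights x).comp
    (continuous_const.add (continuous_tailLoad hlam hg0 hg1 hgi))
  have hIm : Measurable I := by
    refine (hΦc x).measurable.add (Finset.measurable_sum _ fun j _ => (hgm j).mul ?_)
    exact (hΦc _).measurable.sub (hΦc _).measurable
  have hIb : ∀ v, ‖I v‖ ≤ 1 + ∑ _j : ι, 1 := fun v => by
    refine (norm_add_le _ _).trans (add_le_add ?_ ((norm_sum_le _ _).trans
      (Finset.sum_le_sum fun j _ => ?_)))
    · rw [Real.norm_of_nonneg (hΦ0 x v)]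
      exact hΦ1 x v
    · rw [norm_mul, Real.norm_of_nonneg (hg0 j v)]
      refine mul_le_one₀ (hg1 j v) (norm_nonneg _) ?_
      rw [Real.norm_eq_abs, abs_le]
      constructor <;> linarith [hΦ0 x v, hΦ1 x v, hΦ0 (x - Pi.single j 1) v,
        hΦ1 (x - Pi.single j 1) v]
  have hexp : IntegrableOn (fun v => lam * Real.exp (-(lam * v))) (Set.Ioi 0) := by
    simpa only [neg_mul, IntegrableOn] using (exp_neg_integrableOn_Ioi 0 hlam).const_mul lam
  have hint : IntegrableOn (fun v => lam * Real.exp (-(lam * v)) * I v) (Set.Ioi 0) :=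
    Integrable.mul_bdd (c := 1 + ∑ _j : ι, 1) hexp hIm.aestronglyMeasurable
      (Eventually.of_forall hIb)
  rw [integral_expMeasure hlam]
  refine tendsto_nhds_unique (intervalIntegral_tendsto_integral_Ioi 0 hint tendsto_id) ?_
  set F : ℝ → ℝ := fun v => Real.exp (-(lam * v)) * Φ x v with hF
  -- Since `g` is only measurable, `F` need not be differentiable everywhere; absolute continuity
  -- still gives the fundamental theorem of calculus.
  have hac : ∀ b, AbsolutelyContinuousOnInterval F 0 b := fun b => by
    refine AbsolutelyContinuousOnInterval.mul (f := fun v => Real.exp (-(lam * v))) ?_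
      (absolutelyContinuousOnInterval_prod _ fun j _ => ?_)
    · exact ContDiffOn.absolutelyContinuousOnInterval (by fun_prop)
    · refine ((lipschitzOnWith_poissonWeight (x j)).comp (s := Set.univ)
        (f := fun v => (c + tailLoad lam g v) j) (K := lam.toNNReal)
        ?_ fun v _ => hw v j).mono (Set.subset_univ _) |>.absolutelyContinuousOnInterval
      have := lipschitzWith_tailLoad hlam hg0 hg1 hgi j
      refine LipschitzWith.lipschitzOnWith ?_
      refine LipschitzWith.of_dist_le_mul fun a b => ?_
      simpa using this.dist_le_mul a b
  have hderiv : ∀ᵐ v, deriv F v = -(lam * Real.exp (-(lam * v)) * I v) := by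
    have h1 : ∀ᵐ v, ∀ j, HasDerivAt (fun a => (c + tailLoad lam g a) j) (-(lam * g j v)) v := by
      rw [ae_all_iff]
      intro j
      filter_upwards [LocallyIntegrable.ae_hasDerivAt_integral (hgi j).locallyIntegrable] with v hv
      have := (((hv 0).const_mul lam).const_sub (tailLoad lam g 0 j)).const_add (c j)
      refine this.congr_of_eventuallyEq (Eventually.of_forall fun a => ?_)
      change c j + tailLoad lam g a j = _
      rw [tailLoad_eq hgi]
    filter_upwards [h1] with v hv
    have h2 := hasDerivAt_poissonWeights x hv
    have h3 : HasDerivAt (fun v => Real.exp (-(lam * v))) (Real.exp (-(lam * v)) * -(lam * 1)) v :=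
      ((hasDerivAt_id v).const_mul lam).neg.exp
    refine (h3.mul h2).deriv.trans ?_
    simp only [hI, hΦ, mul_add, Finset.mul_sum, neg_add]
    congr 1
    · change _ * poissonWeights (c + tailLoad lam g v) x = _
      ring
    · rw [← Finset.sum_neg_distrib]
      refine Finset.sum_congr rfl fun j _ => ?_
      change _ * (_ * (poissonWeights (c + tailLoad lam g v) _ -
        poissonWeights (c + tailLoad lam g v) _)) = _
      ring
  have hftc : ∀ b, ∫ v in (0)..b, lam * Real.exp (-(lam * v)) * I v = Φ x 0 - F b := fun b => by
    have h := (hac b).integral_deriv_eq_sub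
    rw [intervalIntegral.integral_congr_ae (hderiv.mono fun v hv _ => hv),
      intervalIntegral.integral_neg] at h
    have h0 : F 0 = Φ x 0 := by simp [hF]
    linarith
  have hFlim : Tendsto F atTop (𝓝 0) := by
    refine squeeze_zero (fun v => mul_nonneg (Real.exp_pos _).le (hΦ0 x v))
      (fun v => mul_le_of_le_one_right (Real.exp_pos _).le (hΦ1 x v)) ?_
    exact Real.tendsto_exp_neg_atTop_nhds_zero.comp (tendsto_id.const_mul_atTop hlam)
  simpa only [hftc, id, sub_zero] using hFlim.const_sub (Φ x 0)

end Product

/-! ### Counting the points of a marked renewal process -/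

section Count

open Classical in
theorem eventually_count_eq_encard {H : Set ℕ} (hH : H.Finite) :
    ∀ᶠ n in atTop, ((Nat.count (· ∈ H) n : ℕ) : ℕ∞) = H.encard := by
  obtain ⟨K, hK⟩ := hH.bddAbove
  filter_upwards [eventually_gt_atTop K] with n hn
  have : H = ((Finset.range n).filter (· ∈ H) : Finset ℕ) := by
    ext k
    simp only [Finset.coe_filter, Finset.mem_range, Set.mem_ofPred_eq]
    exact ⟨fun h => ⟨lt_of_le_of_lt (hK h) hn, h⟩, fun h => h.2⟩
  conv_rhs => rw [this, Set.encard_coe_eq_coe_finsetCard]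
  rw [Nat.count_eq_card_filter_range]

open Classical in
theorem tendsto_count_atTop {H : Set ℕ} (hH : H.Infinite) :
    Tendsto (Nat.count (· ∈ H)) atTop atTop :=
  tendsto_atTop_atTop_of_monotone (Nat.count_monotone _)
    fun b => ⟨Nat.nth (· ∈ H) b,
      (Nat.count_nth_of_infinite (p := (· ∈ H)) hH b).ge⟩

open Classical in
theorem eventually_count_add_count_eq {H K : Set ℕ} {m : ℕ} (h : H.encard + K.encard = m) :
    ∀ᶠ n in atTop, Nat.count (· ∈ H) n + Nat.count (· ∈ K) n = m := by
  have hH : H.Finite := Set.encard_ne_top_iff.1 fun h' => by simp [h'] at h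
  have hK : K.Finite := Set.encard_ne_top_iff.1 fun h' => by simp [h'] at h
  filter_upwards [eventually_count_eq_encard hH, eventually_count_eq_encard hK] with n h1 h2
  rw [← h1, ← h2] at h
  exact_mod_cast h

-- An infinite hit set is harmless: its partial counts eventually exceed `m`.
open Classical in
theorem eventually_count_add_count_ne {H K : Set ℕ} {m : ℕ} (h : H.encard + K.encard ≠ m) :
    ∀ᶠ n in atTop, Nat.count (· ∈ H) n + Nat.count (· ∈ K) n ≠ m := by
  by_cases hH : H.Finite
  · by_cases hK : K.Finite
    · filter_upwards [eventually_count_eq_encard hH, eventually_count_eq_encard hK] with n h1 h2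
      rw [← h1, ← h2] at h
      exact_mod_cast h
    · filter_upwards [(tendsto_count_atTop hK).eventually_gt_atTop m] with n hn
      omega
  · filter_upwards [(tendsto_count_atTop hH).eventually_gt_atTop m] with n hn
    omega

end Count

/-! ### The prediction martingale of a marked renewal process -/

section Renewal

variable {M ι Ω : Type*}

/-- The indicator vector of the sets `D j` that contain a point. -/
noncomputable def hits (D : ι → Set (ℝ × M)) (p : ℝ × M) : ι → ℤ :=
  fun j => (D j).indicator 1 p

/-- The time of the `n`-th point of the renewal process with gaps and marks `ξ`, and the numbers
of the first `n` marked points in the sets `D j`. -/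
noncomputable def renewalState (D : ι → Set (ℝ × M)) (ξ : ℕ → Ω → ℝ × M) :
    ℕ → Ω → ℝ × (ι → ℤ)
  | 0, _ => 0
  | n + 1, ω => ((renewalState D ξ n ω).1 + (ξ n ω).1,
      (renewalState D ξ n ω).2 + hits D ((renewalState D ξ n ω).1 + (ξ n ω).1, (ξ n ω).2))

theorem renewalState_fst (D : ι → Set (ℝ × M)) (ξ : ℕ → Ω → ℝ × M) (n : ℕ) (ω : Ω) :
    (renewalState D ξ n ω).1 = ∑ k ∈ Finset.range n, (ξ k ω).1 := by
  induction n with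
  | zero => rfl
  | succ n ih => rw [Finset.sum_range_succ, ← ih]; rfl

/-- The indices of the marked points of a renewal process in `D j`. -/
def hitIndices (D : ι → Set (ℝ × M)) (ξ : ℕ → Ω → ℝ × M) (j : ι) (ω : Ω) : Set ℕ :=
  {n | (∑ k ∈ Finset.range (n + 1), (ξ k ω).1, (ξ n ω).2) ∈ D j}

open Classical in
theorem renewalState_snd (D : ι → Set (ℝ × M)) (ξ : ℕ → Ω → ℝ × M) (n : ℕ) (ω : Ω) (j : ι) :
    (renewalState D ξ n ω).2 j = Nat.count (· ∈ hitIndices D ξ j ω) n := by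
  induction n with
  | zero => simp [renewalState]
  | succ n ih =>
    rw [Nat.count_succ, Nat.cast_add, ← ih, renewalState]
    simp only [Pi.add_apply, hits, Set.indicator, Pi.one_apply, hitIndices, Set.mem_ofPred_eq,
      Finset.sum_range_succ, renewalState_fst]
    split_ifs <;> simp

/-- A point lies in at most one `D j`, so its hit vector is zero or a unit vector. The resulting
form is linear in the indicators and can be averaged over the mark. -/
theorem poissonWeights_sub_hits [Fintype ι] [DecidableEq ι] (D : ι → Set (ℝ × M)) {p : ℝ × M}
    (hp : ∀ i j, p ∈ D i → p ∈ D j → i = j) (w : ι → ℝ) (x : ι → ℤ) :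
    poissonWeights w (x - hits D p) = poissonWeights w x +
      ∑ j, (D j).indicator 1 p * (poissonWeights w (x - Pi.single j 1) - poissonWeights w x) := by
  by_cases h : ∃ j, p ∈ D j
  · obtain ⟨j, hj⟩ := h
    have hne : ∀ i ≠ j, p ∉ D i := fun i hi h => hi (hp i j h hj)
    have hh : hits D p = Pi.single j 1 := by
      ext i
      by_cases hi : i = j
      · subst hi; simp [hits, hj]
      · simp [hits, hi, hne i hi]
    rw [Finset.sum_eq_single j (fun i _ hi => by simp [hne i hi]) (by simp), hh]
    simp [hj]
  · push Not at h
    have hh : hits D p = 0 := by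
      ext i
      simp [hits, h i]
    simp [hh, h]

variable [MeasurableSpace M]

theorem measurable_hits {D : ι → Set (ℝ × M)} (hD : ∀ j, MeasurableSet (D j)) :
    Measurable (hits D) :=
  measurable_pi_lambda _ fun j => measurable_one.indicator (hD j)

theorem measurable_renewalState {D : ι → Set (ℝ × M)} (hD : ∀ j, MeasurableSet (D j))
    {ξ : ℕ → Ω → ℝ × M} {m : MeasurableSpace Ω} {n : ℕ} (hξ : ∀ k < n, Measurable (ξ k)) :
    Measurable (renewalState D ξ n) := by
  induction n with
  | zero => exact measurable_const
  | succ n ih =>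
    have h1 := ih fun k hk => hξ k (by omega)
    have h2 := hξ n (by omega)
    have h3 : Measurable fun ω => (renewalState D ξ n ω).1 + (ξ n ω).1 := h1.fst.add h2.fst
    exact h3.prodMk (h1.snd.add ((measurable_hits hD).comp (h3.prodMk h2.snd)))

section MarkProb

variable (μ : Measure M) {D : ι → Set (ℝ × M)}

/-- The probability that a point at time `a` falls into `D j`. -/
noncomputable def markProb (D : ι → Set (ℝ × M)) (j : ι) (a : ℝ) : ℝ :=
  μ.real {s | (a, s) ∈ D j}

theorem measurable_markProb [IsProbabilityMeasure μ] (hD : ∀ j, MeasurableSet (D j)) (j : ι) :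
    Measurable (markProb μ D j) :=
  (measurable_measure_prodMk_left (hD j)).ennreal_toReal

theorem markProb_nonneg : 0 ≤ markProb μ D := fun _ _ => measureReal_nonneg

theorem markProb_le_one [IsProbabilityMeasure μ] : markProb μ D ≤ 1 := fun _ _ => measureReal_le_one

end MarkProb

theorem integral_indepFun_comp {α β : Type*} [MeasurableSpace α] [MeasurableSpace β]
    [MeasurableSpace Ω] {P : Measure Ω} [IsProbabilityMeasure P] {X : Ω → α} {Y : Ω → β}
    (h : IndepFun X Y P) (hX : Measurable X) (hY : Measurable Y) {f : α × β → ℝ}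
    (hf : Measurable f) {C : ℝ} (hC : ∀ p, ‖f p‖ ≤ C) :
    ∫ ω, f (X ω, Y ω) ∂P = ∫ ω, ∫ ω', f (X ω, Y ω') ∂P ∂P := by
  have := Measure.isProbabilityMeasure_map (μ := P) hX.aemeasurable
  have := Measure.isProbabilityMeasure_map (μ := P) hY.aemeasurable
  have hmap := integral_map (μ := P) (hX.prodMk hY).aemeasurable
    (hf.aestronglyMeasurable (μ := P.map fun ω => (X ω, Y ω)))
  rw [← hmap, h.map_prod_eq_prod_map_map hX.aemeasurable hY.aemeasurable,
    integral_prod _ (Integrable.of_bound hf.aestronglyMeasurable C (Eventually.of_forall hC)),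
    integral_map hX.aemeasurable]
  · congr 1 with ω
    rw [integral_map hY.aemeasurable]
    exact (hf.comp measurable_prodMk_left).aestronglyMeasurable
  · exact hf.stronglyMeasurable.integral_prod_right'.aestronglyMeasurable

variable [Fintype ι]

theorem measurable_poissonWeights : Measurable fun p : (ι → ℝ) × (ι → ℤ) =>
    poissonWeights p.1 p.2 := by
  have : Measurable fun p : ℝ × ℤ => poissonWeight p.1 p.2 :=
    measurable_from_prod_countable_left fun k => (continuous_poissonWeight k).measurable
  unfold poissonWeights
  refine Finset.measurable_prod _ fun j _ => ?_
  have hj : Measurable fun p : (ι → ℝ) × (ι → ℤ) => (p.1 j, p.2 j) := by fun_prop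
  exact this.comp hj

variable [DecidableEq ι]

variable (μ : Measure M) [IsProbabilityMeasure μ] {D : ι → Set (ℝ × M)}

theorem integral_poissonWeights_sub_hits (hD : ∀ j, MeasurableSet (D j))
    (hdisj : ∀ᵐ s ∂μ, ∀ a i j, (a, s) ∈ D i → (a, s) ∈ D j → i = j) (w : ι → ℝ) (x : ι → ℤ)
    (a : ℝ) :
    ∫ s, poissonWeights w (x - hits D (a, s)) ∂μ = poissonWeights w x +
      ∑ j, markProb μ D j a * (poissonWeights w (x - Pi.single j 1) - poissonWeights w x) := by
  have hsec : ∀ j, MeasurableSet {s | (a, s) ∈ D j} := fun j => measurable_prodMk_left (hD j)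
  have hind : ∀ j s, (D j).indicator (1 : ℝ × M → ℝ) (a, s) =
      {s | (a, s) ∈ D j}.indicator 1 s := fun j s => rfl
  have hint : ∀ j, Integrable ({s | (a, s) ∈ D j}.indicator (1 : M → ℝ)) μ := fun j =>
    (integrable_const 1).indicator (hsec j)
  rw [integral_congr_ae (hdisj.mono fun s hs => poissonWeights_sub_hits D (hs a) w x)]
  simp only [hind]
  rw [integral_add (integrable_const _) (integrable_finsetSum _ fun j _ => (hint j).mul_const _),
    integral_finsetSum _ fun j _ => (hint j).mul_const _]
  simp only [integral_const, probReal_univ, one_smul, integral_mul_const,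
    integral_indicator_one (hsec _)]
  rfl

variable {lam : ℝ}

/-- One step of the martingale that predicts the final numbers of points in the sets `D j`. -/
theorem integral_prod_poissonWeights_sub_hits (hlam : 0 < lam) (hD : ∀ j, MeasurableSet (D j))
    (hdisj : ∀ᵐ s ∂μ, ∀ a i j, (a, s) ∈ D i → (a, s) ∈ D j → i = j)
    (hgi : ∀ j, Integrable (markProb μ D j)) {c : ι → ℝ} (hc : 0 ≤ c) (x : ι → ℤ) (a : ℝ) :
    ∫ y, poissonWeights (c + tailLoad lam (markProb μ D) (a + y.1))
      (x - hits D (a + y.1, y.2)) ∂((expMeasure lam).prod μ) =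
      poissonWeights (c + tailLoad lam (markProb μ D) a) x := by
  have := isProbabilityMeasure_expMeasure hlam
  have hL := (continuous_tailLoad hlam (markProb_nonneg μ) (markProb_le_one μ) hgi).measurable
  have hL0 := tailLoad_nonneg hlam (markProb_nonneg μ (D := D))
  have hmeas : Measurable fun y : ℝ × M => poissonWeights
      (c + tailLoad lam (markProb μ D) (a + y.1)) (x - hits D (a + y.1, y.2)) := by
    have h1 : Measurable fun y : ℝ × M => a + y.1 := measurable_fst.const_add a
    exact measurable_poissonWeights.comp (((hL.comp h1).const_add c).prodMk
      (((measurable_hits hD).comp (h1.prodMk measurable_snd)).const_sub x))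
  rw [integral_prod _ (Integrable.of_bound hmeas.aestronglyMeasurable 1
    (Eventually.of_forall fun y => ?_))]
  · simp only [integral_poissonWeights_sub_hits μ hD hdisj]
    -- Moving the time origin to `a` reduces the step to one that starts at time `0`.
    have hshift : ∀ v, tailLoad lam (markProb μ D) (a + v) =
        tailLoad lam (fun j v => markProb μ D j (a + v)) v := fun v => by
      ext j
      rw [tailLoad, tailLoad, setIntegral_Ioi_comp_add]
    have h := integral_exp_mul_poissonWeights_tailLoad (g := fun j v => markProb μ D j (a + v))
      hlam (fun j v => markProb_nonneg μ j (a + v)) (fun j v => markProb_le_one μ j (a + v))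
      (fun j => (measurable_markProb μ hD j).comp (measurable_const_add a))
      (fun j => (hgi j).comp_add_left a) hc x
    simp only [← hshift, add_zero] at h
    exact h
  · have hw := add_nonneg hc (hL0 (a + y.1))
    rw [Real.norm_of_nonneg (poissonWeights_nonneg hw _)]
    exact poissonWeights_le_one hw _

variable [MeasurableSpace Ω] {P : Measure Ω} [IsProbabilityMeasure P]

/-- The state after `n` points is independent of the next gap and mark. Freezing that state and
averaging over the next point is the one-step identity, with the current time as `a` and the counts
still missing as `x`. -/
theorem integral_poissonWeights_renewalState (hlam : 0 < lam) (hD : ∀ j, MeasurableSet (D j))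
    (hdisj : ∀ᵐ s ∂μ, ∀ a i j, (a, s) ∈ D i → (a, s) ∈ D j → i = j)
    (hgi : ∀ j, Integrable (markProb μ D j)) {ξ : ℕ → Ω → ℝ × M} (hξ : ∀ n, Measurable (ξ n))
    (hlaw : ∀ n, P.map (ξ n) = (expMeasure lam).prod μ) (hind : iIndepFun ξ P)
    {c : ι → ℝ} (hc : 0 ≤ c) (x : ι → ℤ) (n : ℕ) :
    ∫ ω, poissonWeights (c + tailLoad lam (markProb μ D) (renewalState D ξ n ω).1)
      (x - (renewalState D ξ n ω).2) ∂P =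
      poissonWeights (c + tailLoad lam (markProb μ D) 0) x := by
  have hL := (continuous_tailLoad hlam (markProb_nonneg μ) (markProb_le_one μ) hgi).measurable
  have hL0 := tailLoad_nonneg hlam (markProb_nonneg μ (D := D))
  induction n with
  | zero => simp [renewalState]
  | succ n ih =>
    have hindep : IndepFun (renewalState D ξ n) (ξ n) P := by
      have h := indep_iSup_of_disjoint (fun i => (hξ i).comap_le)
        (show iIndep (fun i => MeasurableSpace.comap (ξ i) inferInstance) P from hind)
        (S := Set.Iio n) (T := {n}) (by simp)
      rw [iSup_singleton] at h
      refine indep_of_indep_of_le_left h (Measurable.comap_le ?_)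
      exact measurable_renewalState hD fun k hk => measurable_iff_comap_le.2
        (le_iSup₂ (f := fun i (_ : i ∈ Set.Iio n) => MeasurableSpace.comap (ξ i) inferInstance)
          k hk)
    set f : (ℝ × (ι → ℤ)) × (ℝ × M) → ℝ := fun p =>
      poissonWeights (c + tailLoad lam (markProb μ D) (p.1.1 + p.2.1))
        (x - (p.1.2 + hits D (p.1.1 + p.2.1, p.2.2))) with hf
    have hfm : Measurable f := by
      have h1 : Measurable fun p : (ℝ × (ι → ℤ)) × (ℝ × M) => p.1.1 + p.2.1 := by fun_prop
      refine measurable_poissonWeights.comp (((hL.comp h1).const_add c).prodMk (Measurable.const_sub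
        (measurable_fst.snd.add ((measurable_hits hD).comp (h1.prodMk measurable_snd.snd))) x))
    have hfb : ∀ p, ‖f p‖ ≤ 1 := fun p => by
      have hw := add_nonneg hc (hL0 (p.1.1 + p.2.1))
      rw [Real.norm_of_nonneg (poissonWeights_nonneg hw _)]
      exact poissonWeights_le_one hw _
    refine (integral_indepFun_comp hindep (measurable_renewalState hD fun k _ => hξ k) (hξ n)
      hfm hfb).trans ?_
    rw [← ih]
    congr 1 with ω
    have hstep := integral_prod_poissonWeights_sub_hits μ hlam hD hdisj hgi hc
      (x - (renewalState D ξ n ω).2) (renewalState D ξ n ω).1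
    rw [← hlaw n, integral_map (hξ n).aemeasurable] at hstep
    · rw [← hstep]
      simp only [hf, sub_sub]
    · have := hfm.comp (measurable_prodMk_left (x := renewalState D ξ n ω))
      simp only [hf, ← sub_sub] at this
      exact Measurable.aestronglyMeasurable this

/-- Gaps truncated to `[0, 1]` are bounded with positive mean, so by the strong law their sums grow
linearly; the gaps are almost surely positive and dominate their truncations. -/
theorem ae_tendsto_sum_gaps (hlam : 0 < lam) {ξ : ℕ → Ω → ℝ × M} (hξ : ∀ n, Measurable (ξ n))
    (hlaw : ∀ n, P.map (ξ n) = (expMeasure lam).prod μ) (hind : iIndepFun ξ P) :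
    ∀ᵐ ω ∂P, Tendsto (fun n => ∑ k ∈ Finset.range n, (ξ k ω).1) atTop atTop := by
  have := isProbabilityMeasure_expMeasure hlam
  set T : ℝ × M → ℝ := fun y => min 1 (max 0 y.1) with hT
  have hTm : Measurable T := by fun_prop
  have hgap : ∀ n, P.map (fun ω => (ξ n ω).1) = expMeasure lam := fun n => by
    rw [← Function.comp_def, ← Measure.map_map measurable_fst (hξ n), hlaw, Measure.map_fst_prod]
    simp
  have hint : Integrable (fun ω => T (ξ 0 ω)) P :=
    Integrable.of_bound (hTm.comp (hξ 0)).aestronglyMeasurable 1 (Eventually.of_forall fun ω => by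
      rw [Real.norm_of_nonneg (by positivity)]
      exact min_le_left _ _)
  have hident : ∀ n, IdentDistrib (fun ω => T (ξ n ω)) (fun ω => T (ξ 0 ω)) P P := fun n =>
    (IdentDistrib.mk (hξ n).aemeasurable (hξ 0).aemeasurable
      (by rw [hlaw, hlaw])).comp hTm
  have hslln := strong_law_ae_real (fun n ω => T (ξ n ω)) hint
    (fun i j hij => (hind.indepFun hij).comp hTm hTm) hident
  have hexp : ∀ᵐ v ∂(expMeasure lam), 0 < v := by
    have hm : Measurable (exponentialPDF lam) :=
      (measurable_exponentialPDFReal lam).ennreal_ofReal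
    rw [show expMeasure lam = volume.withDensity (exponentialPDF lam) from rfl,
      ae_withDensity_iff hm]
    filter_upwards [(Set.countable_singleton (0 : ℝ)).ae_notMem volume] with v hv0 hv
    by_contra h
    exact hv (exponentialPDF_of_neg (lt_of_le_of_ne (not_lt.1 h) (by simpa using hv0)))
  have hgap0 : ∀ n, ∀ᵐ ω ∂P, 0 < (ξ n ω).1 := fun n => by
    have := hexp
    rw [← hgap n] at this
    exact ae_of_ae_map (measurable_fst.comp (hξ n)).aemeasurable this
  have hmean : 0 < ∫ ω, T (ξ 0 ω) ∂P := by
    rw [integral_pos_iff_support_of_nonneg (fun ω => by positivity) hint]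
    have : (Function.support fun ω => T (ξ 0 ω)) =ᵐ[P] Set.univ := by
      filter_upwards [hgap0 0] with ω hω
      refine propext ⟨fun _ => trivial, fun _ => ?_⟩
      change min 1 (max 0 (ξ 0 ω).1) ≠ 0
      positivity
    rw [measure_congr this]
    simp
  filter_upwards [hslln, ae_all_iff.2 hgap0] with ω h1 h2
  have h3 : Tendsto (fun n : ℕ => ∑ k ∈ Finset.range n, T (ξ k ω)) atTop atTop := by
    refine (h1.pos_mul_atTop hmean tendsto_natCast_atTop_atTop).congr' ?_
    filter_upwards [eventually_gt_atTop 0] with n hn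
    have : (n : ℝ) ≠ 0 := by positivity
    field_simp
  refine tendsto_atTop_mono (fun n => Finset.sum_le_sum fun k _ => ?_) h3
  exact (min_le_right _ _).trans_eq (max_eq_right (h2 k).le)

end Renewal

/-! ### Joint counts of two independent marked Poisson processes -/

section TwoSided

variable {M ι Ω : Type*} [MeasurableSpace M] [Fintype ι] [DecidableEq ι]
  (μ : Measure M) [IsProbabilityMeasure μ] {lam : ℝ}
  [MeasurableSpace Ω] {P : Measure Ω} [IsProbabilityMeasure P] {D D' : ι → Set (ℝ × M)}
  {ξ ξ' : ℕ → Ω → ℝ × M}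

/-- Fubini reduces this to the one-process statement twice: first the primed state is frozen and its
tail load serves as `c`, then `c` is the full load of the other process. -/
theorem integral_poissonWeights_renewalState_renewalState (hlam : 0 < lam)
    (hD : ∀ j, MeasurableSet (D j)) (hD' : ∀ j, MeasurableSet (D' j))
    (hdisj : ∀ᵐ s ∂μ, ∀ a i j, (a, s) ∈ D i → (a, s) ∈ D j → i = j)
    (hdisj' : ∀ᵐ s ∂μ, ∀ a i j, (a, s) ∈ D' i → (a, s) ∈ D' j → i = j)
    (hgi : ∀ j, Integrable (markProb μ D j)) (hgi' : ∀ j, Integrable (markProb μ D' j))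
    (hξ : ∀ n, Measurable (ξ n)) (hξ' : ∀ n, Measurable (ξ' n))
    (hlaw : ∀ n, P.map (ξ n) = (expMeasure lam).prod μ)
    (hlaw' : ∀ n, P.map (ξ' n) = (expMeasure lam).prod μ)
    (hind : iIndepFun ξ P) (hind' : iIndepFun ξ' P)
    (hindep : ∀ n, IndepFun (renewalState D' ξ' n) (renewalState D ξ n) P)
    (x : ι → ℤ) (n : ℕ) :
    ∫ ω, poissonWeights (tailLoad lam (markProb μ D') (renewalState D' ξ' n ω).1 +
        tailLoad lam (markProb μ D) (renewalState D ξ n ω).1)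
      (x - (renewalState D' ξ' n ω).2 - (renewalState D ξ n ω).2) ∂P =
      poissonWeights (tailLoad lam (markProb μ D) 0 + tailLoad lam (markProb μ D') 0) x := by
  have hL := (continuous_tailLoad hlam (markProb_nonneg μ) (markProb_le_one μ) hgi).measurable
  have hL0 := tailLoad_nonneg hlam (markProb_nonneg μ (D := D))
  have hL' := (continuous_tailLoad hlam (markProb_nonneg μ) (markProb_le_one μ) hgi').measurable
  have hL0' := tailLoad_nonneg hlam (markProb_nonneg μ (D := D'))
  set f : (ℝ × (ι → ℤ)) × (ℝ × (ι → ℤ)) → ℝ := fun p =>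
    poissonWeights (tailLoad lam (markProb μ D') p.1.1 + tailLoad lam (markProb μ D) p.2.1)
      (x - p.1.2 - p.2.2)
  have hfm : Measurable f := measurable_poissonWeights.comp
    (((hL'.comp measurable_fst.fst).add (hL.comp measurable_snd.fst)).prodMk
      ((measurable_fst.snd.const_sub x).sub measurable_snd.snd))
  have hfb : ∀ p, ‖f p‖ ≤ 1 := fun p => by
    have hw := add_nonneg (hL0' p.1.1) (hL0 p.2.1)
    rw [Real.norm_of_nonneg (poissonWeights_nonneg hw _)]
    exact poissonWeights_le_one hw _
  have hinner : ∀ ω, ∫ ω', f (renewalState D' ξ' n ω, renewalState D ξ n ω') ∂P =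
      poissonWeights (tailLoad lam (markProb μ D) 0 +
        tailLoad lam (markProb μ D') (renewalState D' ξ' n ω).1)
        (x - (renewalState D' ξ' n ω).2) := fun ω => by
    rw [add_comm (tailLoad lam (markProb μ D) 0)]
    exact integral_poissonWeights_renewalState μ hlam hD hdisj hgi hξ hlaw hind
      (hL0' (renewalState D' ξ' n ω).1) (x - (renewalState D' ξ' n ω).2) n
  calc _ = ∫ ω, ∫ ω', f (renewalState D' ξ' n ω, renewalState D ξ n ω') ∂P ∂P :=
        integral_indepFun_comp (hindep n) (measurable_renewalState hD' fun k _ => hξ' k)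
          (measurable_renewalState hD fun k _ => hξ k) hfm hfb
    _ = _ := by
      simp only [hinner]
      exact integral_poissonWeights_renewalState μ hlam hD' hdisj' hgi' hξ' hlaw' hind' (hL0 0) x n

open Classical in
/-- The numbers of points in disjoint sets `D j` of two independent marked Poisson processes are
independent Poisson variables. -/
theorem measure_encard_hitIndices_add_eq (hlam : 0 < lam)
    (hD : ∀ j, MeasurableSet (D j)) (hD' : ∀ j, MeasurableSet (D' j))
    (hdisj : ∀ᵐ s ∂μ, ∀ a i j, (a, s) ∈ D i → (a, s) ∈ D j → i = j)
    (hdisj' : ∀ᵐ s ∂μ, ∀ a i j, (a, s) ∈ D' i → (a, s) ∈ D' j → i = j)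
    (hgi : ∀ j, Integrable (markProb μ D j)) (hgi' : ∀ j, Integrable (markProb μ D' j))
    (hξ : ∀ n, Measurable (ξ n)) (hξ' : ∀ n, Measurable (ξ' n))
    (hlaw : ∀ n, P.map (ξ n) = (expMeasure lam).prod μ)
    (hlaw' : ∀ n, P.map (ξ' n) = (expMeasure lam).prod μ)
    (hind : iIndepFun ξ P) (hind' : iIndepFun ξ' P)
    (hindep : ∀ n, IndepFun (renewalState D' ξ' n) (renewalState D ξ n) P)
    (x : ι → ℕ) :
    P {ω | ∀ j, (hitIndices D ξ j ω).encard + (hitIndices D' ξ' j ω).encard = x j} =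
      ENNReal.ofReal (poissonWeights
        (tailLoad lam (markProb μ D) 0 + tailLoad lam (markProb μ D') 0) fun j => x j) := by
  set A := {ω | ∀ j, (hitIndices D ξ j ω).encard + (hitIndices D' ξ' j ω).encard = x j} with hA
  have hL := (continuous_tailLoad hlam (markProb_nonneg μ) (markProb_le_one μ) hgi).measurable
  have hL' := (continuous_tailLoad hlam (markProb_nonneg μ) (markProb_le_one μ) hgi').measurable
  set w : ℕ → Ω → ι → ℝ := fun n ω => tailLoad lam (markProb μ D') (renewalState D' ξ' n ω).1 +
    tailLoad lam (markProb μ D) (renewalState D ξ n ω).1 with hw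
  set d : ℕ → Ω → ι → ℤ := fun n ω =>
    (fun j => (x j : ℤ)) - (renewalState D' ξ' n ω).2 - (renewalState D ξ n ω).2 with hd
  have hdj : ∀ n ω j, d n ω j = x j - ((Nat.count (· ∈ hitIndices D ξ j ω) n +
      Nat.count (· ∈ hitIndices D' ξ' j ω) n : ℕ) : ℤ) := fun n ω j => by
    simp only [hd, Pi.sub_apply, renewalState_snd]
    push_cast
    ring
  have hw0 : ∀ n ω, 0 ≤ w n ω := fun n ω =>
    add_nonneg (tailLoad_nonneg hlam (markProb_nonneg μ) _)
      (tailLoad_nonneg hlam (markProb_nonneg μ) _)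
  have hmeas : ∀ n, Measurable fun ω => poissonWeights (w n ω) (d n ω) := fun n => by
    have h1 := measurable_renewalState hD (n := n) fun k _ => hξ k
    have h2 := measurable_renewalState hD' (n := n) fun k _ => hξ' k
    exact measurable_poissonWeights.comp (((hL'.comp h2.fst).add (hL.comp h1.fst)).prodMk
      ((h2.snd.const_sub _).sub h1.snd))
  have hbound : ∀ n ω, ‖poissonWeights (w n ω) (d n ω)‖ ≤ 1 := fun n ω => by
    rw [Real.norm_of_nonneg (poissonWeights_nonneg (hw0 n ω) _)]
    exact poissonWeights_le_one (hw0 n ω) _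
  -- On `A` the missing counts are eventually zero, and the weight of `0` tends to `1` as the means
  -- vanish. Off `A` some missing count is eventually nonzero, so the weight is at most the
  -- vanishing mean `w n ω j`.
  have hlim : ∀ᵐ ω ∂P, Tendsto (fun n => poissonWeights (w n ω) (d n ω)) atTop
      (𝓝 (A.indicator (fun _ => 1) ω)) := by
    filter_upwards [ae_tendsto_sum_gaps μ hlam hξ hlaw hind,
      ae_tendsto_sum_gaps μ hlam hξ' hlaw' hind'] with ω h1 h2
    have hwlim : Tendsto (fun n => w n ω) atTop (𝓝 0) := by
      simp only [hw, renewalState_fst]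
      simpa using ((tendsto_tailLoad hgi').comp h2).add ((tendsto_tailLoad hgi).comp h1)
    by_cases hω : ω ∈ A
    · rw [Set.indicator_of_mem hω]
      have hd0 : ∀ᶠ n in atTop, d n ω = 0 := by
        have : ∀ᶠ n in atTop, ∀ j, Nat.count (· ∈ hitIndices D ξ j ω) n +
            Nat.count (· ∈ hitIndices D' ξ' j ω) n = x j :=
          eventually_all.2 fun j => eventually_count_add_count_eq (hω j)
        filter_upwards [this] with n hn
        ext j
        rw [hdj, hn]
        simp
      have := ((continuous_poissonWeights (0 : ι → ℤ)).tendsto 0).comp hwlim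
      rw [poissonWeights_zero_right] at this
      simp only [Pi.zero_apply, neg_zero, Real.exp_zero, Finset.prod_const_one] at this
      refine this.congr' ?_
      filter_upwards [hd0] with n hn
      simp [hn]
    · rw [Set.indicator_of_notMem hω]
      obtain ⟨j, hj⟩ : ∃ j, (hitIndices D ξ j ω).encard + (hitIndices D' ξ' j ω).encard ≠ x j := by
        simpa [hA] using hω
      refine tendsto_of_tendsto_of_tendsto_of_le_of_le' tendsto_const_nhds
        (tendsto_pi_nhds.1 hwlim j)
        (Eventually.of_forall fun n => poissonWeights_nonneg (hw0 n ω) _) ?_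
      filter_upwards [eventually_count_add_count_ne hj] with n hn
      refine poissonWeights_le (hw0 n ω) ?_
      rw [hdj]
      omega
  -- The indicator of `A` is an almost sure limit of measurable functions.
  have hAm : NullMeasurableSet A P := by
    rw [← aemeasurable_indicator_const_iff (1 : ℝ)]
    exact aemeasurable_of_tendsto_metrizable_ae atTop (fun n => (hmeas n).aemeasurable) hlim
  have hint := tendsto_integral_of_dominated_convergence (fun _ => (1 : ℝ))
    (fun n => (hmeas n).aestronglyMeasurable) (integrable_const 1)
    (fun n => Eventually.of_forall (hbound n)) hlim
  have hconst := fun n => integral_poissonWeights_renewalState_renewalState μ hlam hD hD' hdisj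
    hdisj' hgi hgi' hξ hξ' hlaw hlaw' hind hind' hindep (fun j => (x j : ℤ)) n
  change ∀ n, ∫ ω, poissonWeights (w n ω) (d n ω) ∂P = _ at hconst
  simp only [hconst] at hint
  rw [tendsto_nhds_unique tendsto_const_nhds hint, integral_indicator₀ hAm, setIntegral_const,
    smul_eq_mul, mul_one, measureReal_def, ENNReal.ofReal_toReal (measure_ne_top _ _)]

end TwoSided

/-- The pairs formed from two independent families of independent random variables are
independent. -/
theorem iIndepFun_prodMk {Ω ι α β : Type*} [MeasurableSpace Ω] [MeasurableSpace α]
    [MeasurableSpace β] {P : Measure Ω} {f : ι → Ω → α} {g : ι → Ω → β}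
    (hfm : ∀ i, Measurable (f i)) (hgm : ∀ i, Measurable (g i))
    (hf : iIndepFun f P) (hg : iIndepFun g P)
    (hfg : IndepFun (fun ω i => f i ω) (fun ω i => g i ω) P) :
    iIndepFun (fun i ω => (f i ω, g i ω)) P := by
  rw [iIndepFun_iff_iIndep]
  refine iIndepSets.iIndep (fun i => ((hfm i).prodMk (hgm i)).comap_le)
    (fun i => {s | ∃ t ∈ Set.image2 (fun (s : Set α) (t : Set β) => s ×ˢ t)
      {s | MeasurableSet s} {t | MeasurableSet t}, (fun ω => (f i ω, g i ω)) ⁻¹' t = s})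
    (fun i => isPiSystem_prod.comap _) (fun i => ?_) ?_
  · rw [← generateFrom_prod, MeasurableSpace.comap_generateFrom]
    rfl
  · refine (iIndepSets_iff _ _).2 fun I s hs => ?_
    have : ∀ i ∈ I, ∃ a b, MeasurableSet a ∧ MeasurableSet b ∧ f i ⁻¹' a ∩ g i ⁻¹' b = s i := by
      intro i hi
      obtain ⟨_, ⟨a, ha, b, hb, rfl⟩, h⟩ := hs i hi
      exact ⟨a, b, ha, hb, by rw [← h]; rfl⟩
    choose! a b ha hb hab using this
    have h1 : ∀ i ∈ I, P (s i) = P (f i ⁻¹' a i) * P (g i ⁻¹' b i) := fun i hi => by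
      rw [← hab i hi]
      exact (hfg.comp (measurable_pi_apply i) (measurable_pi_apply i)).measure_inter_preimage_eq_mul
        _ _ (ha i hi) (hb i hi)
    have h2 : ⋂ i ∈ I, s i = (fun ω i => f i ω) ⁻¹' (I : Set ι).pi a ∩
        (fun ω i => g i ω) ⁻¹' (I : Set ι).pi b := by
      rw [Set.iInter₂_congr fun i hi => (hab i hi).symm]
      ext ω
      simp [Set.mem_pi, forall_and]
    have h3 : (fun ω i => f i ω) ⁻¹' (I : Set ι).pi a = ⋂ i ∈ I, f i ⁻¹' a i := by
      ext ω
      simp [Set.mem_pi]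
    have h4 : (fun ω i => g i ω) ⁻¹' (I : Set ι).pi b = ⋂ i ∈ I, g i ⁻¹' b i := by
      ext ω
      simp [Set.mem_pi]
    rw [h2, hfg.measure_inter_preimage_eq_mul _ _ (MeasurableSet.pi I.countable_toSet ha)
      (MeasurableSet.pi I.countable_toSet hb), h3, h4,
      hf.meas_biInter fun i hi => ⟨a i, ha i hi, rfl⟩,
      hg.meas_biInter fun i hi => ⟨b i, hb i hi, rfl⟩, ← Finset.prod_mul_distrib]
    exact (Finset.prod_congr rfl h1).symm

/-! ### The stage of a session as a function of its age -/

section Stage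

variable {N : ℕ}

theorem inStage_iff_sub (a : ℝ) (s : Session N) (j : Fin N) (t : ℝ) :
    InStage a s j t ↔ InStage 0 s j (t - a) := by
  unfold InStage
  rw [zero_add, le_sub_iff_add_le', sub_lt_iff_lt_add', add_assoc]

theorem measurableSet_inStage {α : Type*} [MeasurableSpace α] {f g : α → ℝ} {h : α → Session N}
    (hf : Measurable f) (hg : Measurable g) (hh : Measurable h) (j : Fin N) :
    MeasurableSet {p | InStage (f p) (h p) j (g p)} := by
  have h1 := (measurable_entryAge j).comp hh
  have h2 := (measurable_holdingTime j).comp hh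
  exact (hh (measurableSet_reaches j)).inter
    ((measurableSet_le (hf.add h1) hg).inter (measurableSet_lt hg ((hf.add h1).add h2)))

theorem InStage.unique {a t : ℝ} {s : Session N} (hs : ∀ j, 0 ≤ s.2 j) {i j : Fin N}
    (hi : InStage a s i t) (hj : InStage a s j t) : i = j := by
  have key : ∀ {i j : Fin N}, i < j → InStage a s i t → InStage a s j t → False := by
    intro i j hij hi hj
    have h1 : entryAge s i + s.2 i ≤ entryAge s j := by
      unfold entryAge
      rw [add_comm, ← Finset.sum_insert (by simp)]
      refine Finset.sum_le_sum_of_subset_of_nonneg (fun k hk => ?_) fun k _ _ => hs k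
      rcases Finset.mem_insert.1 hk with rfl | hk
      · exact Finset.mem_Iio.2 hij
      · exact Finset.mem_Iio.2 ((Finset.mem_Iio.1 hk).trans hij)
    have h2 : holdingTime s i ≤ s.2 i := min_le_right _ _
    linarith [hi.2.2, hj.2.1]
  rcases lt_trichotomy i j with h | h | h
  exacts [(key h hi hj).elim, h, (key h hj hi).elim]

theorem Reaches.holdingTime_nonneg {s : Session N} (hT : 0 ≤ s.1) (hs : ∀ j, 0 ≤ s.2 j)
    {j : Fin N} (h : Reaches s j) : 0 ≤ holdingTime s j := by
  refine le_min ?_ (hs j)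
  rcases h with h | h
  · have : Finset.Iio j = ∅ := by
      ext i
      simp only [Finset.mem_Iio, Fin.lt_def, Finset.notMem_empty, iff_false]
      omega
    simpa [entryAge, this] using hT
  · exact sub_nonneg.2 h.le

variable (μ : Measure (Session N))

/-- The probability that a session is in stage `j` at age `v`. -/
noncomputable def stageProb (j : Fin N) (v : ℝ) : ℝ :=
  μ.real {s | InStage 0 s j v}

theorem stageProb_nonneg (j : Fin N) : 0 ≤ stageProb μ j := fun _ => measureReal_nonneg

variable [IsProbabilityMeasure μ]

/-- Tonelli: the ages at which a session that reaches stage `j` is in it form a half-open interval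
whose length is the holding time. -/
theorem lintegral_stageProb (j : Fin N) :
    ∫⁻ v, ENNReal.ofReal (stageProb μ j v) =
      ∫⁻ s in {s | Reaches s j}, ENNReal.ofReal (holdingTime s j) ∂μ := by
  have hm : MeasurableSet {p : ℝ × Session N | InStage 0 p.2 j p.1} :=
    measurableSet_inStage measurable_const measurable_fst measurable_snd j
  have h1 := Measure.prod_apply (μ := volume) (ν := μ) hm
  rw [Measure.prod_apply_symm hm] at h1
  have hreal : ∀ v, ENNReal.ofReal (stageProb μ j v) = μ {s | InStage 0 s j v} := fun v =>
    ofReal_measureReal (measure_ne_top _ _)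
  simp only [hreal]
  refine h1.symm.trans ?_
  rw [← lintegral_indicator (measurableSet_reaches j)]
  refine lintegral_congr fun s => ?_
  by_cases hs : Reaches s j
  · rw [Set.indicator_of_mem (show s ∈ {s | Reaches s j} from hs)]
    have : (fun v : ℝ => (v, s)) ⁻¹' {p : ℝ × Session N | InStage 0 p.2 j p.1} =
        Set.Ico (entryAge s j) (entryAge s j + holdingTime s j) := by
      ext v
      simp [InStage, hs]
    rw [this, Real.volume_Ico, add_sub_cancel_left]
  · rw [Set.indicator_of_notMem (show s ∉ {s | Reaches s j} from hs)]
    have : (fun v : ℝ => (v, s)) ⁻¹' {p : ℝ × Session N | InStage 0 p.2 j p.1} = ∅ := by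
      ext v
      simp [InStage, hs]
    rw [this, measure_empty]

theorem measurable_stageProb (j : Fin N) : Measurable (stageProb μ j) :=
  (measurable_measure_prodMk_left
    (measurableSet_inStage measurable_const measurable_fst measurable_snd j :
      MeasurableSet {p : ℝ × Session N | InStage 0 p.2 j p.1})).ennreal_toReal

variable {μ} {j : Fin N}

theorem integrable_stageProb (hj : IntegrableOn (fun s => holdingTime s j) {s | Reaches s j} μ) :
    Integrable (stageProb μ j) := by
  refine ⟨(measurable_stageProb μ j).aestronglyMeasurable, ?_⟩
  rw [hasFiniteIntegral_iff_ofReal (Eventually.of_forall (stageProb_nonneg μ j))]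
  rw [lintegral_stageProb]
  exact hj.lintegral_lt_top

theorem integral_stageProb (hT : ∀ᵐ s ∂μ, 0 ≤ s.1) (hτ : ∀ᵐ s ∂μ, ∀ j, 0 ≤ s.2 j)
    (hj : IntegrableOn (fun s => holdingTime s j) {s | Reaches s j} μ) :
    ∫ v, stageProb μ j v = ∫ s in {s | Reaches s j}, holdingTime s j ∂μ := by
  rw [integral_eq_lintegral_of_nonneg_ae (Eventually.of_forall (stageProb_nonneg μ j))
    (measurable_stageProb μ j).aestronglyMeasurable, integral_eq_lintegral_of_nonneg_ae _
    hj.aestronglyMeasurable]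
  · rw [lintegral_stageProb]
  · filter_upwards [ae_restrict_mem (measurableSet_reaches j), ae_restrict_of_ae hT,
      ae_restrict_of_ae hτ] with s h1 h2 h3
    exact Reaches.holdingTime_nonneg h2 h3 h1

end Stage

/-! ### Splitting the arrivals at time `0` into two renewal processes -/

section Arrivals

variable {Ω : Type*} {N : ℕ} (E : ℤ → Ω → ℝ) (S : ℤ → Ω → Session N)

theorem arrivalTime_natCast_add_one (n : ℕ) (ω : Ω) :
    arrivalTime E (n + 1) ω = ∑ k ∈ Finset.range (n + 1), E (k + 1) ω := by
  rw [arrivalTime, if_pos (by omega)]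
  refine (Finset.sum_nbij (fun k : ℕ => (k : ℤ) + 1) (fun k hk => ?_) (fun a _ b _ h => ?_)
    (fun i hi => ?_) fun k _ => rfl).symm
  · simp only [Finset.mem_range, Finset.mem_Icc] at hk ⊢
    omega
  · simpa using h
  · simp only [Finset.coe_Icc, Set.mem_Icc] at hi
    exact ⟨(i - 1).toNat, by simp; omega, by simp; omega⟩

theorem arrivalTime_neg_natCast (n : ℕ) (ω : Ω) :
    arrivalTime E (-n) ω = -∑ k ∈ Finset.range (n + 1), E (-k) ω := by
  rw [arrivalTime, if_neg (by omega)]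
  congr 1
  refine (Finset.sum_nbij (fun k : ℕ => -(k : ℤ)) (fun k hk => ?_) (fun a _ b _ h => ?_)
    (fun i hi => ?_) fun k _ => rfl).symm
  · simp only [Finset.mem_range, Finset.mem_Icc] at hk ⊢
    omega
  · simpa using h
  · simp only [Finset.coe_Icc, Set.mem_Icc] at hi
    exact ⟨(-i).toNat, by simp; omega, by simp; omega⟩

/-- The gaps and sessions after time `0`. -/
def futureMarks (n : ℕ) (ω : Ω) : ℝ × Session N := (E (n + 1) ω, S (n + 1) ω)

/-- The gaps and sessions before time `0`, in reverse order. -/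
def pastMarks (n : ℕ) (ω : Ω) : ℝ × Session N := (E (-n) ω, S (-n) ω)

/-- The arrival times and sessions after time `0` for which the session is in stage `j` at time
`t`. -/
def futureStage (t : ℝ) (j : Fin N) : Set (ℝ × Session N) := {p | InStage p.1 p.2 j t}

/-- The arrival times before time `0`, with the sign reversed, and sessions for which the session
is in stage `j` at time `t`. -/
def pastStage (t : ℝ) (j : Fin N) : Set (ℝ × Session N) := {p | InStage (-p.1) p.2 j t}

theorem occupancy_Ioi (t : ℝ) (ω : Ω) (j : Fin N) :
    occupancy E S (Set.Ioi 0) t ω j =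
      (hitIndices (futureStage t) (futureMarks E S) j ω).encard := by
  have hinj : Function.Injective fun k : ℕ => (k : ℤ) + 1 := fun a b h => by simpa using h
  rw [occupancy, ← hinj.encard_image]
  congr 1
  ext n
  simp only [Set.mem_ofPred_eq, Set.mem_Ioi, Set.mem_image, hitIndices, futureStage, futureMarks]
  constructor
  · rintro ⟨hn, h⟩
    refine ⟨(n - 1).toNat, ?_, by omega⟩
    have : (((n - 1).toNat : ℕ) : ℤ) + 1 = n := by omega
    rwa [← arrivalTime_natCast_add_one, this]
  · rintro ⟨k, h, rfl⟩
    rw [← arrivalTime_natCast_add_one] at h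
    exact ⟨by omega, h⟩

theorem occupancy_univ (t : ℝ) (ω : Ω) (j : Fin N) :
    occupancy E S Set.univ t ω j =
      (hitIndices (futureStage t) (futureMarks E S) j ω).encard +
      (hitIndices (pastStage t) (pastMarks E S) j ω).encard := by
  have hinj : Function.Injective fun k : ℕ => -(k : ℤ) := fun a b h => by simpa using h
  have hpast : occupancy E S (Set.Iic 0) t ω j =
      (hitIndices (pastStage t) (pastMarks E S) j ω).encard := by
    rw [occupancy, ← hinj.encard_image]
    congr 1
    ext n
    simp only [Set.mem_ofPred_eq, Set.mem_Iic, Set.mem_image, hitIndices, pastStage, pastMarks]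
    constructor
    · rintro ⟨hn, h⟩
      refine ⟨(-n).toNat, ?_, by omega⟩
      have : -(((-n).toNat : ℕ) : ℤ) = n := by omega
      rwa [← arrivalTime_neg_natCast, this]
    · rintro ⟨k, h, rfl⟩
      rw [← arrivalTime_neg_natCast] at h
      exact ⟨by omega, h⟩
  rw [← hpast, ← occupancy_Ioi, occupancy, occupancy, occupancy, ← Set.encard_union_eq]
  · congr 1
    ext n
    simp only [Set.mem_ofPred_eq, Set.mem_union, Set.mem_univ, Set.mem_Ioi, Set.mem_Iic]
    rcases lt_or_ge 0 n with h | h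
    · simp [h, not_le.2 h]
    · simp [h, not_lt.2 h]
  · refine Set.disjoint_left.2 fun n h1 h2 => ?_
    exact absurd (Set.mem_Ioi.1 h1.1) (not_lt.2 h2.1)

end Arrivals

/-! ### The law of the stage occupancies -/

section Law

variable {N : ℕ} {lam : ℝ} {μ : Measure (Session N)}

theorem markProb_futureStage (t : ℝ) (j : Fin N) (a : ℝ) :
    markProb μ (futureStage t) j a = stageProb μ j (t - a) := by
  simp only [markProb, futureStage, Set.mem_ofPred_eq, stageProb, ← inStage_iff_sub]

theorem markProb_pastStage (t : ℝ) (j : Fin N) (a : ℝ) :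
    markProb μ (pastStage t) j a = stageProb μ j (t + a) := by
  simp only [markProb, pastStage, Set.mem_ofPred_eq, stageProb]
  simp only [inStage_iff_sub (-a), sub_neg_eq_add]

theorem measurableSet_futureStage (t : ℝ) (j : Fin N) : MeasurableSet (futureStage t j) :=
  measurableSet_inStage measurable_fst measurable_const measurable_snd j

theorem measurableSet_pastStage (t : ℝ) (j : Fin N) : MeasurableSet (pastStage t j) :=
  measurableSet_inStage measurable_fst.neg measurable_const measurable_snd j

theorem tailLoad_pastStage (t : ℝ) (j : Fin N) :
    tailLoad lam (markProb μ (pastStage t)) 0 j = lam * ∫ v in Set.Ioi t, stageProb μ j v := by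
  simp only [tailLoad, markProb_pastStage]
  rw [setIntegral_Ioi_comp_add, add_zero]

/-- Arrivals after time `0` have age below `t` at time `t`, those before have age above `t`; the two
loads therefore add up to the integral over all ages. -/
theorem tailLoad_futureStage [IsProbabilityMeasure μ]
    (hint : ∀ j, IntegrableOn (fun s => holdingTime s j) {s | Reaches s j} μ)
    (t : ℝ) (j : Fin N) :
    tailLoad lam (markProb μ (futureStage t)) 0 j =
      lam * (∫ v, stageProb μ j v) - lam * ∫ v in Set.Ioi t, stageProb μ j v := by
  have hG := (integrable_stageProb (hint j)).comp_add_left t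
  have h1 := integral_comp_neg_Ioi (0 : ℝ) fun v => stageProb μ j (t + v)
  have h2 := integral_add_compl (measurableSet_Ioi (a := (0 : ℝ))) hG
  have h3 := setIntegral_Ioi_comp_add (stageProb μ j) t 0
  have h4 : ∫ v, stageProb μ j (t + v) = ∫ v, stageProb μ j v := integral_add_left_eq_self _ t
  rw [Set.compl_Ioi, h3, add_zero, h4] at h2
  simp only [tailLoad, markProb_futureStage, sub_eq_add_neg]
  rw [h1, neg_zero, ← mul_neg, ← mul_add, ← h2]
  ring

variable {Ω : Type*} [MeasurableSpace Ω] {P : Measure Ω}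
  {E : ℤ → Ω → ℝ} {S : ℤ → Ω → Session N}

/-- `HasLaw` gives only almost everywhere measurability. Passing to measurable versions alters the
countably many variables on a common null set, which does not affect occupancy probabilities. -/
theorem IsSessionStream.exists_measurable (hS : IsSessionStream P lam μ E S) :
    ∃ (E' : ℤ → Ω → ℝ) (S' : ℤ → Ω → Session N), IsSessionStream P lam μ E' S' ∧
      (∀ n, Measurable (E' n)) ∧ (∀ n, Measurable (S' n)) ∧
      ∀ᵐ ω ∂P, (∀ n, E n ω = E' n ω) ∧ ∀ n, S n ω = S' n ω := by
  have hE := fun n => (hS.hasLaw_gap n).aemeasurable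
  have hM := fun n => (hS.hasLaw_session n).aemeasurable
  have hE' := ae_all_iff.2 fun n => (hE n).ae_eq_mk
  have hM' := ae_all_iff.2 fun n => (hM n).ae_eq_mk
  refine ⟨fun n => (hE n).mk, fun n => (hM n).mk, ⟨fun n => ?_, fun n => ?_, ?_, ?_, ?_⟩,
    fun n => (hE n).measurable_mk, fun n => (hM n).measurable_mk, hE'.and hM'⟩
  · exact (hS.hasLaw_gap n).congr (hE n).ae_eq_mk.symm
  · exact (hS.hasLaw_session n).congr (hM n).ae_eq_mk.symm
  · exact (iIndepFun_congr fun n => (hE n).ae_eq_mk).1 hS.indep_gap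
  · exact (iIndepFun_congr fun n => (hM n).ae_eq_mk).1 hS.indep_session
  · refine hS.indep.congr ?_ ?_
    · filter_upwards [hE'] with ω h using funext h
    · filter_upwards [hM'] with ω h using funext h

theorem measure_occupancy_congr {E' : ℤ → Ω → ℝ} {S' : ℤ → Ω → Session N}
    (h : ∀ᵐ ω ∂P, (∀ n, E n ω = E' n ω) ∧ ∀ n, S n ω = S' n ω) (I : Set ℤ) (t : ℝ)
    (x : Fin N → ℕ) :
    P {ω | ∀ j, occupancy E S I t ω j = x j} = P {ω | ∀ j, occupancy E' S' I t ω j = x j} := by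
  refine measure_congr ?_
  filter_upwards [h] with ω hω
  have harr : ∀ n, arrivalTime E n ω = arrivalTime E' n ω := fun n => by
    simp only [arrivalTime, hω.1]
  have : ∀ j, occupancy E S I t ω j = occupancy E' S' I t ω j := fun j => by
    simp only [occupancy, harr, hω.2]
  exact propext (forall_congr' fun j => by rw [this j])

theorem poissonWeights_natCast (w : Fin N → ℝ) (x : Fin N → ℕ) :
    poissonWeights w (fun j => (x j : ℤ)) = poissonProduct w x := by
  simp [poissonWeights, poissonProduct]

/-- The numbers of sessions in the stages at time `t` that have an arrival after time `0`, or
before time `0` with a mark in `D`, are independent Poisson variables. -/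
theorem IsSessionStream.measure_encard_hitIndices [IsProbabilityMeasure μ]
    [IsProbabilityMeasure P] (hlam : 0 < lam)
    (hτ : ∀ᵐ s ∂μ, ∀ j, 0 ≤ s.2 j)
    (hint : ∀ j, IntegrableOn (fun s => holdingTime s j) {s | Reaches s j} μ)
    (hS : IsSessionStream P lam μ E S) (hE : ∀ n, Measurable (E n)) (hM : ∀ n, Measurable (S n))
    {D : Fin N → Set (ℝ × Session N)} (hD : ∀ j, MeasurableSet (D j))
    (hdisj : ∀ᵐ s ∂μ, ∀ a i j, (a, s) ∈ D i → (a, s) ∈ D j → i = j)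
    (hgi : ∀ j, Integrable (markProb μ D j)) (t : ℝ) (x : Fin N → ℕ) :
    P {ω | ∀ j, (hitIndices (futureStage t) (futureMarks E S) j ω).encard +
      (hitIndices D (pastMarks E S) j ω).encard = x j} =
      ENNReal.ofReal (poissonProduct
        (tailLoad lam (markProb μ (futureStage t)) 0 + tailLoad lam (markProb μ D) 0) x) := by
  have hXm : ∀ n, Measurable fun ω => (E n ω, S n ω) := fun n => (hE n).prodMk (hM n)
  have hX : iIndepFun (fun n ω => (E n ω, S n ω)) P :=
    iIndepFun_prodMk hE hM hS.indep_gap hS.indep_session hS.indep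
  have hlaw : ∀ n, P.map (fun ω => (E n ω, S n ω)) = (expMeasure lam).prod μ := fun n => by
    have h := (hS.indep.comp (measurable_pi_apply n) (measurable_pi_apply n) : IndepFun (E n) (S n) P)
    rw [h.map_prod_eq_prod_map_map (hE n).aemeasurable (hM n).aemeasurable,
      (hS.hasLaw_gap n).map_eq, (hS.hasLaw_session n).map_eq]
  rw [← poissonWeights_natCast]
  refine measure_encard_hitIndices_add_eq μ hlam (measurableSet_futureStage t) hD ?_ hdisj
    (fun j => ?_) hgi (fun n => hXm _) (fun n => hXm _) (fun n => hlaw _) (fun n => hlaw _)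
    (hX.precomp (g := fun n : ℕ => (n : ℤ) + 1) fun a b h => by simpa using h)
    (hX.precomp (g := fun n : ℕ => -(n : ℤ)) fun a b h => by simpa using h) (fun n => ?_) x
  · filter_upwards [hτ] with s hs a i j hi hj
    exact InStage.unique hs hi hj
  · have : markProb μ (futureStage t) j = fun a => stageProb μ j (t - a) :=
      funext (markProb_futureStage t j)
    rw [this]
    exact (integrable_stageProb (hint j)).comp_sub_left t
  · have h := indep_iSup_of_disjoint (fun i => (hXm i).comap_le)
      (show iIndep (fun n => MeasurableSpace.comap (fun ω => (E n ω, S n ω)) inferInstance) P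
        from hX) (S := Set.Iic 0) (T := Set.Ioi 0) (Set.Iic_disjoint_Ioi le_rfl)
    have hle : ∀ (T : Set ℤ) (i : ℤ), i ∈ T → Measurable[⨆ i ∈ T,
        MeasurableSpace.comap (fun ω => (E i ω, S i ω)) inferInstance] fun ω => (E i ω, S i ω) :=
      fun T i hi => measurable_iff_comap_le.2 (le_iSup₂ (f := fun i (_ : i ∈ T) =>
        MeasurableSpace.comap (fun ω => (E i ω, S i ω)) inferInstance) i hi)
    refine indep_of_indep_of_le h (Measurable.comap_le ?_) (Measurable.comap_le ?_)
    · exact measurable_renewalState hD fun k _ => hle _ _ (by simp)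
    · exact measurable_renewalState (measurableSet_futureStage t) fun k _ =>
        hle _ _ (by simp)

end Law

end SingleRoute

/-! ### The theorem -/

theorem mainTheorem1 {N : ℕ} (hN : 1 ≤ N) (lam : ℝ) (hlam : 0 < lam)
    (μ : Measure (SingleRoute.Session N)) [IsProbabilityMeasure μ]
    (hT : ∀ᵐ s ∂μ, 0 ≤ s.1) (hτ : ∀ᵐ s ∂μ, ∀ j, 0 ≤ s.2 j)
    (hreach : ∀ j, 0 < μ {s | SingleRoute.Reaches s j})
    (hint : ∀ j, IntegrableOn (fun s => SingleRoute.holdingTime s j)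
      {s | SingleRoute.Reaches s j} μ)
    (hmean : ∀ j, 0 < SingleRoute.meanHolding μ j)
    {Ω : Type*} [MeasurableSpace Ω] (P : Measure Ω) [IsProbabilityMeasure P]
    (E : ℤ → Ω → ℝ) (S : ℤ → Ω → SingleRoute.Session N)
    (hS : SingleRoute.IsSessionStream P lam μ E S) :
    ∃ π : (Fin N → ℕ) → ℝ,
      -- the product of the Poisson laws with means `w j`
      (∀ x, π x = ∏ j, Real.exp (-SingleRoute.load lam μ j) *
        SingleRoute.load lam μ j ^ x j / (x j)!) ∧
      -- is the unique stationary distribution of the memoryless network,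
      (∀ π₀ : (Fin N → ℕ) → ℝ, SingleRoute.IsStationaryDistribution
        (SingleRoute.memorylessRate lam μ) π₀ ↔ π₀ = π) ∧
      -- the law of the stage occupancies of the single-route network in the stationary regime,
      (∀ (t : ℝ) (x : Fin N → ℕ),
        P {ω | ∀ j, SingleRoute.occupancy E S Set.univ t ω j = x j} = ENNReal.ofReal (π x)) ∧
      -- and their limit law for the network that is empty at time `0`
      (∀ x : Fin N → ℕ, Tendsto
        (fun t : ℝ => P {ω | ∀ j, SingleRoute.occupancy E S (Set.Ioi 0) t ω j = x j})
        atTop (𝓝 (ENNReal.ofReal (π x)))) := by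
  obtain ⟨E', S', hS', hE, hM, hae⟩ := hS.exists_measurable
  have hload : ∀ j, lam * ∫ v, SingleRoute.stageProb μ j v = SingleRoute.load lam μ j := fun j => by
    rw [SingleRoute.integral_stageProb hT hτ (hint j),
      SingleRoute.load_eq_setIntegral μ lam hτ hN j (hreach j)]
  refine ⟨SingleRoute.poissonProduct (SingleRoute.load lam μ), fun x => rfl,
    SingleRoute.isStationaryDistribution_memorylessRate_iff μ hN hlam hτ hreach hmean,
    fun t x => ?_, fun x => ?_⟩
  · rw [SingleRoute.measure_occupancy_congr hae]
    simp only [SingleRoute.occupancy_univ]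
    rw [hS'.measure_encard_hitIndices hlam hτ hint hE hM
      (SingleRoute.measurableSet_pastStage t) ?_ fun j => ?_]
    · congr 2
      ext j
      rw [Pi.add_apply, SingleRoute.tailLoad_futureStage hint, SingleRoute.tailLoad_pastStage,
        hload, sub_add_cancel]
    · filter_upwards [hτ] with s hs a i j hi hj
      exact SingleRoute.InStage.unique hs hi hj
    · have : SingleRoute.markProb μ (SingleRoute.pastStage t) j =
          fun a => SingleRoute.stageProb μ j (t + a) :=
        funext (SingleRoute.markProb_pastStage t j)
      rw [this]
      exact (SingleRoute.integrable_stageProb (hint j)).comp_add_left t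
  · have hlaw : ∀ t : ℝ, P {ω | ∀ j, SingleRoute.occupancy E S (Set.Ioi 0) t ω j = x j} =
        ENNReal.ofReal (SingleRoute.poissonProduct
          (SingleRoute.tailLoad lam (SingleRoute.markProb μ (SingleRoute.futureStage t)) 0) x) := by
      intro t
      have hprob : SingleRoute.markProb μ (fun _ : Fin N => ∅) = 0 := by
        ext j a
        simp [SingleRoute.markProb]
      -- Empty target sets discard the sessions that arrived before time `0`, so the two-sided
      -- statement also covers the initially empty network.
      have h := hS'.measure_encard_hitIndices hlam hτ hint hE hM (D := fun _ => ∅)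
        (fun _ => MeasurableSet.empty) (by simp) (fun j => by rw [hprob]; exact integrable_zero _ _ _)
        t x
      have hempty : ∀ j ω, SingleRoute.hitIndices (fun _ : Fin N => ∅)
          (SingleRoute.pastMarks E' S') j ω = ∅ := fun j ω => by
        simp [SingleRoute.hitIndices]
      have hzero : SingleRoute.tailLoad lam (SingleRoute.markProb μ (fun _ : Fin N => ∅)) 0 = 0 := by
        ext j
        simp [SingleRoute.tailLoad, hprob]
      rw [hzero, add_zero] at h
      simp only [hempty, Set.encard_empty, add_zero] at h
      rw [SingleRoute.measure_occupancy_congr hae]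
      simpa only [SingleRoute.occupancy_Ioi] using h
    simp only [hlaw, ← SingleRoute.poissonWeights_natCast]
    refine ENNReal.tendsto_ofReal
      (((SingleRoute.continuous_poissonWeights _).tendsto _).comp (tendsto_pi_nhds.2 fun j => ?_))
    simp only [SingleRoute.tailLoad_futureStage hint, hload]
    simpa using ((SingleRoute.tendsto_setIntegral_Ioi
      (SingleRoute.integrable_stageProb (hint j))).const_mul lam).const_sub
        (SingleRoute.load lam μ j)
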